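/- Let $\Gamma$ be a finite connected undirected graph (loops and multiple edges allowed) with vertex set $V$ and strictly positive weights $\mu:V\to(0,\infty)$. Its directed version has two opposite edges $\epsilon,\epsilon^{op}$ for every edge with distinct ends, and one edge $\epsilon=\epsilon^{op}$ for every loop; $s$ and $t$ denote source and target. Let $\mathcal F$ be the Fock space with orthonormal basis the finite directed paths, the paths of length $0$ being the vertices. Let $p_\beta$ be the projection onto the span of the paths that start at $\beta$, let $\ell(\epsilon)$ be the creation operator that puts $\epsilon$ in front of a path starting at $t(\epsilon)$ and kills all other paths, and put $$X_\epsilon=a_\epsilon\,\ell(\epsilon)+a_\epsilon^{-1}\,\ell(\epsilon^{op})^*,\qquad a_\epsilon=\sqrt[4]{\mu(s(\epsilon))/\mu(t(\epsilon))}.$$ Let $\mathcal A$ be the algebra generated by all $X_\epsilon$ and all $p_\beta$, let $\mathcal S(\Gamma,\mu)$ be its norm closure, and let $\mathrm{Tr}(x)=\sum_{\beta\in V}\mu(\beta)\langle\beta,x\,\beta\rangle$. For self-adjoint $P\in M_n(\mathcal A)$ let $\mu_P$ be its law with respect to $\mathrm{Tr}\otimes\mathrm{tr}_n$ ($\mathrm{tr}_n$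 the normalized trace), that is, the finite measure on the spectrum of $P$ with moments $\int x^k\,d\mu_P(x)=(\mathrm{Tr}\otimes\mathrm{tr}_n)(P^k)$, $k\ge 0$; write $F_{\mu_P}(t)=\mu_P((-\infty,t])$. Let $n\ge 1$ and let $P\in M_n(\mathcal A)$ be positive. Then: 1. $t\mapsto \frac{1}{t}\bigl(F_{\mu_P}(t)-F_{\mu_P}(0)\bigr)$ is integrable on $(0,\|P\|]$; that is, $\displaystyle\lim_{\delta\to0^+}\int_\delta^{\|P\|}\frac{1}{t}\bigl(F_{\mu_P}(t)-F_{\mu_P}(0)\bigr)\,dt$ exists and is finite. 2. $\log$ is $\mu_P$-integrable on $(0,\|P\|]$; that is, $\displaystyle\lim_{\delta\to0^+}\int_{[\delta,\|P\|]}\log t\,d\mu_P(t)$ exists and is finite. In particular, let $\alpha\in V$ satisfy $\mu(\alpha)=\min_{\beta\in V}\mu(\beta)$, let $P\in\mathcal A$ be positive and nonzero with $P=p_\alpha Pp_\alpha$, and let $\mu'_P$ be the law of $P$ in the corner $p_\alpha\mathcal S(\Gamma,\mu)p_\alpha$ (with unit $p_\alpha$) with respect to $\mathrm{Tr}$. Then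 $\mu'_P(\{0\})=0$ and $\int_{[0,\|P\|]}\log t\,d\mu'_P(t)>-\infty$, that is, $\log$ is $\mu'_P$-integrable on $[0,\|P\|]$. -/

import Mathlib

open MeasureTheory Set Filter Topology
open scoped NNReal ENNReal ComplexOrder Graph CompactlySupported

noncomputable section

/-! ### The law of a self-adjoint element -/

section Law

variable {B : Type*} [CStarAlgebra B] [PartialOrder B] [StarOrderedRing B]

/-- The positive functional `f ↦ φ (f(a))` on the continuous functions on the spectrum of `a`. -/
def spectralFunctional (φ : B →ₚ[ℂ] ℂ) (a : B) (ha : IsSelfAdjoint a) :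
    C_c(spectrum ℝ a, ℝ) →ₚ[ℝ] ℝ :=
  PositiveLinearMap.mk₀
    { toFun := fun f => (φ (cfcHom ha (f : C(spectrum ℝ a, ℝ)))).re
      map_add' := fun f g => by
        have : ((f + g : C_c(spectrum ℝ a, ℝ)) : C(spectrum ℝ a, ℝ))
            = (f : C(spectrum ℝ a, ℝ)) + (g : C(spectrum ℝ a, ℝ)) := rfl
        rw [this, map_add, map_add, Complex.add_re]
      map_smul' := fun r f => by
        have : ((r • f : C_c(spectrum ℝ a, ℝ)) : C(spectrum ℝ a, ℝ))
            = r • (f : C(spectrum ℝ a, ℝ)) := rfl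
        rw [this, map_smul, ← Complex.coe_smul r, map_smul]
        simp }
    (fun f hf => by
      have h : (0 : B) ≤ cfcHom ha (f : C(spectrum ℝ a, ℝ)) := by
        rw [cfcHom_nonneg_iff]
        exact fun x => hf x
      exact (Complex.le_def.mp (map_nonneg φ h)).1)

/-- The law of the self-adjoint element `a` with respect to the positive functional `φ`: the
finite measure on `ℝ`, carried by the spectrum of `a`, with `∫ f dμ = φ (f(a))` for every `f`
continuous on the spectrum. -/
def law (φ : B →ₚ[ℂ] ℂ) (a : B) (ha : IsSelfAdjoint a) : Measure ℝ :=
  (RealRMK.rieszMeasure (spectralFunctional φ a ha)).map Subtype.val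

/-- The moments of the law of `a` are the values of `φ` at the powers of `a`. -/
theorem integral_pow_law (φ : B →ₚ[ℂ] ℂ) (a : B) (ha : IsSelfAdjoint a) (k : ℕ) :
    ∫ x, x ^ k ∂(law φ a ha) = (φ (a ^ k)).re := by
  have hm : MeasurableEmbedding (Subtype.val : spectrum ℝ a → ℝ) :=
    MeasurableEmbedding.subtype_coe (spectrum.isClosed a).measurableSet
  rw [law, hm.integral_map]
  let g : C(spectrum ℝ a, ℝ) := (ContinuousMap.id ℝ).restrict (spectrum ℝ a) ^ k
  let f : C_c(spectrum ℝ a, ℝ) := ⟨g, HasCompactSupport.of_compactSpace _⟩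
  have h := RealRMK.integral_rieszMeasure (spectralFunctional φ a ha) f
  have h2 : spectralFunctional φ a ha f = (φ (cfcHom ha g)).re := rfl
  rw [h2, map_pow, cfcHom_id] at h
  exact h

end Law

namespace FreeGraph

universe u v

variable {V : Type u} {E : Type v}

/-! ### The directed version of a graph and its paths -/

/-- The multigraph `G` is nonempty and any two of its vertices are joined by a path. -/
def IsConnected (G : Graph V E) : Prop :=
  V(G).Nonempty ∧ ∀ x ∈ V(G), ∀ y ∈ V(G), Relation.ReflTransGen G.Adj x y

/-- An edge of the directed version of `G`: an edge of `G` with an ordering of its two ends.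
An edge with distinct ends gives two of them, a loop gives one. -/
@[ext]
structure OEdge (G : Graph V E) where
  /-- the underlying undirected edge -/
  edge : E
  /-- the source -/
  src : V(G)
  /-- the target -/
  tgt : V(G)
  /-- the edge joins its source and its target -/
  isLink : G.IsLink edge src tgt

/-- The opposite directed edge. A loop is its own opposite. -/
def OEdge.op {G : Graph V E} (ε : OEdge G) : OEdge G where
  edge := ε.edge
  src := ε.tgt
  tgt := ε.src
  isLink := ε.isLink.symm

/-- The list of directed edges is a path that starts at the vertex `x`. -/
def IsPathFrom {G : Graph V E} : V(G) → List (OEdge G) → Prop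
  | _, [] => True
  | x, ε :: l => ε.src = x ∧ IsPathFrom ε.tgt l

/-- The finite directed paths, given by the start vertex and the list of edges; the paths with no
edges are the vertices. -/
def DPath (G : Graph V E) : Type (max u v) :=
  {p : V(G) × List (OEdge G) // IsPathFrom p.1 p.2}

/-- The path of length zero at `x`. -/
def DPath.nil {G : Graph V E} (x : V(G)) : DPath G := ⟨(x, []), trivial⟩

/-- The path that starts with the edge `ε` and continues with a path from the target of `ε`. -/
def DPath.cons {G : Graph V E} (ε : OEdge G) (q : DPath G) (h : q.1.1 = ε.tgt) : DPath G :=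
  ⟨(ε.src, ε :: q.1.2), rfl, h ▸ q.2⟩

open Classical in
/-- Removes the first edge of a path if that edge is `ε`; undefined on all other paths. -/
def DPath.strip {G : Graph V E} (ε : OEdge G) : DPath G → Option (DPath G)
  | ⟨(_, []), _⟩ => none
  | ⟨(_, d :: l), h⟩ => if d = ε then some ⟨(d.tgt, l), h.2⟩ else none

theorem DPath.strip_eq_some_iff {G : Graph V E} (ε : OEdge G) (p q : DPath G) :
    DPath.strip ε p = some q ↔ ∃ h : q.1.1 = ε.tgt, p = DPath.cons ε q h := by
  obtain ⟨⟨x, l⟩, hp⟩ := p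
  obtain ⟨⟨y, m⟩, hq⟩ := q
  cases l with
  | nil =>
    simp only [DPath.strip, DPath.cons]
    constructor
    · intro h; cases h
    · rintro ⟨_, h⟩
      have := congrArg (fun r : DPath G => r.1.2) h
      simp at this
  | cons d l =>
    have hp1 : d.src = x := hp.1
    subst hp1
    simp only [DPath.strip, DPath.cons]
    constructor
    · intro h
      split_ifs at h with hd
      · subst hd
        have h' := congrArg (fun r : DPath G => r.1) (Option.some.inj h)
        simp only [Prod.mk.injEq] at h'
        obtain ⟨rfl, rfl⟩ := h'
        exact ⟨rfl, rfl⟩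
    · rintro ⟨h1, h⟩
      have h' := congrArg (fun r : DPath G => r.1) h
      simp only [Prod.mk.injEq, List.cons.injEq] at h'
      obtain ⟨-, rfl, rfl⟩ := h'
      simp only [if_true]
      congr 1
      apply Subtype.ext
      exact Prod.ext h1.symm rfl

open Classical in
/-- The identity on the paths that start at `x`; undefined on all other paths. -/
def DPath.at {G : Graph V E} (x : V(G)) (p : DPath G) : Option (DPath G) :=
  if p.1.1 = x then some p else none

/-! ### Operators on the Fock space -/

/-- The Hilbert space `ℓ²(I)`. -/
abbrev L2 (I : Type*) : Type _ := lp (fun _ : I => ℂ) 2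

theorem elim_summable {I : Type*} (τ : I → Option I)
    (hτ : ∀ i j k, τ i = some k → τ j = some k → i = j) (F : I → ℝ) (hF : Summable F)
    (hF0 : ∀ i, 0 ≤ F i) :
    Summable (fun i => (τ i).elim 0 F) ∧ ∑' i, (τ i).elim 0 F ≤ ∑' i, F i := by
  let D : Set I := {i | (τ i).isSome}
  let g : D → I := fun i => (τ i).get i.2
  have hg : Function.Injective g := by
    intro i j hij
    apply Subtype.ext
    apply hτ i j (g i)
    · exact (Option.some_get i.2).symm
    · rw [hij]; exact (Option.some_get j.2).symm
  have hsub : ∀ i : D, (τ i).elim 0 F = F (g i) := by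
    intro i
    have : τ i = some (g i) := (Option.some_get i.2).symm
    rw [this]; rfl
  have hsupp : Function.support (fun i => (τ i).elim 0 F) ⊆ D := by
    intro i hi
    by_contra h
    apply hi
    have : τ i = none := by simpa [D] using h
    simp [this]
  constructor
  · have h : Summable fun i : D => (τ i).elim 0 F := (hF.comp_injective hg).congr fun i => (hsub i).symm
    exact ((hasSum_subtype_iff_of_support_subset hsupp).1 h.hasSum).summable
  · rw [← tsum_subtype_eq_of_support_subset hsupp]
    calc ∑' i : D, (τ i).elim 0 F = ∑' i : D, F (g i) := tsum_congr hsub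
      _ ≤ ∑' i, F i := tsum_comp_le_tsum_of_inj hF hF0 hg

theorem norm_elim {I : Type*} (o : Option I) (f : I → ℂ) :
    ‖o.elim 0 f‖ ^ (2 : ℝ≥0∞).toReal = o.elim 0 (fun k => ‖f k‖ ^ (2 : ℝ≥0∞).toReal) := by
  cases o <;> simp

theorem summable_norm_rpow {I : Type*} (f : L2 I) :
    Summable (fun i => ‖f i‖ ^ (2 : ℝ≥0∞).toReal) :=
  (lp.memℓp f).summable (by norm_num)

/-- The function `f ∘ τ`, with value zero where the partial map `τ` is undefined. -/
def pullFun {I : Type*} (τ : I → Option I)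
    (hτ : ∀ i j k, τ i = some k → τ j = some k → i = j) (f : L2 I) : L2 I :=
  ⟨fun i => (τ i).elim 0 f, memℓp_gen (by
    simp only [norm_elim]
    exact (elim_summable τ hτ _ (summable_norm_rpow f) (fun i => by positivity)).1)⟩

theorem pullFun_apply {I : Type*} (τ : I → Option I)
    (hτ : ∀ i j k, τ i = some k → τ j = some k → i = j) (f : L2 I) (i : I) :
    pullFun τ hτ f i = (τ i).elim 0 f := rfl

/-- For a partial map `τ` on `I` that is injective where it is defined, the contraction
`f ↦ f ∘ τ` of `ℓ²(I)`, with value zero where `τ` is undefined. It sends the basis vector of `k`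
to the basis vector of `i` if `τ i = k`, and to zero if `k` is not a value of `τ`. -/
def pullback {I : Type*} (τ : I → Option I)
    (hτ : ∀ i j k, τ i = some k → τ j = some k → i = j) : L2 I →L[ℂ] L2 I :=
  LinearMap.mkContinuous
    { toFun := pullFun τ hτ
      map_add' := fun f g => by
        apply lp.ext
        funext i
        rw [lp.coeFn_add, Pi.add_apply, pullFun_apply, pullFun_apply, pullFun_apply, lp.coeFn_add]
        cases τ i with
        | none => exact (add_zero _).symm
        | some k => rfl
      map_smul' := fun c f => by
        apply lp.ext
        funext i
        rw [lp.coeFn_smul, Pi.smul_apply, pullFun_apply, pullFun_apply]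
        cases τ i <;> simp }
    1 (fun f => by
      rw [one_mul]
      refine lp.norm_le_of_tsum_le (by norm_num) (norm_nonneg _) ?_
      rw [lp.norm_rpow_eq_tsum (by norm_num) f]
      refine le_trans (le_of_eq (tsum_congr fun i => norm_elim (τ i) f)) ?_
      exact (elim_summable τ hτ _ (summable_norm_rpow f) (fun i => by positivity)).2)

/-- The full Fock space of the directed version of `G`, as a Hilbert space: the finite paths form
an orthonormal basis. For finite `G` it consists of the same vectors as the Fock space that is a
Hilbert module over the functions on the vertices, whose inner product is obtained by summing
over the paths with a given last vertex only; the bounded module maps of the latter are bounded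
operators here, with the same adjoints and the same norm. -/
abbrev Fock (G : Graph V E) : Type (max u v) := L2 (DPath G)

variable {G : Graph V E}

open Classical in
/-- The basis vector of the path of length zero at `x`. -/
def vac (x : V(G)) : Fock G := lp.single 2 (DPath.nil x) 1

/-- The creation operator `ℓ(ε)`: it puts `ε` in front of a path that starts at the target of
`ε`, and it is zero on all other paths. -/
def creation (ε : OEdge G) : Fock G →L[ℂ] Fock G :=
  pullback (DPath.strip ε) (by
    intro p p' q h h'
    obtain ⟨h1, rfl⟩ := (DPath.strip_eq_some_iff ε p q).1 h
    obtain ⟨h2, rfl⟩ := (DPath.strip_eq_some_iff ε p' q).1 h'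
    rfl)

/-- The projection `p_x` onto the closed span of the paths that start at `x`. -/
def vproj (x : V(G)) : Fock G →L[ℂ] Fock G :=
  pullback (DPath.at x) (by
    intro p p' q h h'
    simp only [DPath.at] at h h'
    split_ifs at h h'
    exact (Option.some.inj h).trans (Option.some.inj h').symm)

/-- The number `a_ε`, the fourth root of `μ(s(ε)) / μ(t(ε))`. -/
def edgeWeight (μ : V(G) → ℝ≥0) (ε : OEdge G) : ℝ := ((μ ε.src : ℝ) / μ ε.tgt) ^ (1 / 4 : ℝ)

/-- The operator `X_ε = a_ε ℓ(ε) + a_ε⁻¹ ℓ(ε^op)^*`. If `ε` is a loop then `a_ε = 1` and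
`ε^op = ε`, so that this is `ℓ(ε) + ℓ(ε)^*`. -/
def edgeOp (μ : V(G) → ℝ≥0) (ε : OEdge G) : Fock G →L[ℂ] Fock G :=
  (edgeWeight μ ε : ℂ) • creation ε +
    ((edgeWeight μ ε)⁻¹ : ℂ) • ContinuousLinearMap.adjoint (creation ε.op)

/-- The algebra `𝒜` generated by the `X_ε` and the `p_x`. -/
def polyAlg (μ : V(G) → ℝ≥0) : Subalgebra ℂ (Fock G →L[ℂ] Fock G) :=
  Algebra.adjoin ℂ (Set.range (edgeOp μ) ∪ Set.range (vproj (G := G)))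

/-! ### The traces -/

/-- The functional `Tr(T) = ∑_x μ(x) ⟨x, T x⟩`, the sum over the vacuum vectors of the vertices. -/
def trace [Fintype V(G)] (μ : V(G) → ℝ≥0) : (Fock G →L[ℂ] Fock G) →ₚ[ℂ] ℂ :=
  PositiveLinearMap.mk₀
    { toFun := fun T => ∑ x : V(G), ((μ x : ℝ) : ℂ) * inner ℂ (vac x) (T (vac x))
      map_add' := fun S T => by
        simp [mul_add, Finset.sum_add_distrib]
      map_smul' := fun c T => by
        simp only [smul_apply, inner_smul_right, RingHom.id_apply, smul_eq_mul,
          Finset.mul_sum]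
        exact Finset.sum_congr rfl fun x _ => by ring }
    (fun T hT => by
      refine Finset.sum_nonneg fun x _ => mul_nonneg ?_ ?_
      · exact_mod_cast (μ x).2
      · rw [ContinuousLinearMap.nonneg_iff_isPositive] at hT
        exact hT.inner_nonneg_right _)

/-- The functional `Tr ⊗ tr_n` on `n × n` matrices, with `tr_n` the normalized trace. -/
def matrixTrace [Fintype V(G)] (μ : V(G) → ℝ≥0) (n : ℕ) :
    CStarMatrix (Fin n) (Fin n) (Fock G →L[ℂ] Fock G) →ₚ[ℂ] ℂ :=
  PositiveLinearMap.mk₀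
    { toFun := fun P => (n : ℂ)⁻¹ * ∑ i, trace μ (P i i)
      map_add' := fun P Q => by
        simp [Finset.sum_add_distrib, mul_add]
      map_smul' := fun c P => by
        simp only [CStarMatrix.smul_apply, map_smul, RingHom.id_apply, smul_eq_mul, Finset.mul_sum]
        exact Finset.sum_congr rfl fun x _ => by ring }
    (fun P hP => by
      refine mul_nonneg ?_ (Finset.sum_nonneg fun i _ => map_nonneg _ ?_)
      · exact inv_nonneg.2 (by exact_mod_cast n.cast_nonneg)
      · rw [StarOrderedRing.nonneg_iff] at hP
        induction hP using AddSubmonoid.closure_induction with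
        | mem Q hQ =>
          obtain ⟨R, rfl⟩ := hQ
          change 0 ≤ (star R * R) i i
          rw [CStarMatrix.mul_apply]
          exact Finset.sum_nonneg fun j _ => star_mul_self_nonneg (R j i)
        | zero => rfl
        | add Q R _ _ hQ hR => exact add_nonneg hQ hR)

/-- The functional `T ↦ Tr(p_x T p_x)`. For `T = p_x T p_x` and `f` continuous, the element
`p_x f(T) p_x` is `f(T)` computed in the corner with unit `p_x`. Hence the law of `T` with
respect to this functional is the law of `T` in the corner, with respect to `Tr`. -/
def cornerTrace [Fintype V(G)] (μ : V(G) → ℝ≥0) (x : V(G)) :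
    (Fock G →L[ℂ] Fock G) →ₚ[ℂ] ℂ :=
  PositiveLinearMap.mk₀
    { toFun := fun T => trace μ (star (vproj x) * T * vproj x)
      map_add' := fun S T => by rw [mul_add, add_mul, map_add]
      map_smul' := fun c T => by
        rw [mul_smul_comm, smul_mul_assoc, map_smul, RingHom.id_apply] }
    (fun T hT => by
      change 0 ≤ trace μ (star (vproj x) * T * vproj x)
      have h := star_left_conjugate_nonneg hT (vproj x)
      exact map_nonneg (trace μ) h)

end FreeGraph

end

noncomputable section

/-! ### The Jacobian criterion for algebraicity -/

/-! The algebra acts on the left end of paths; both halves of the proof exploit operators acting on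
the right end.

Integrability. It suffices that ν((0,t]) ≤ C t^a for some a > 0: then (F(t) - F(0))/t is dominated
by C t^(a-1), and the layer-cake formula bounds the integral of the logarithm. The bound is read off
the resolvent transform ∫ (1+st)⁻¹ dν(t) = φ((1+sP)⁻¹), which is algebraic in u when s = u^k. Indeed
`pencil_linearization` replaces 1 + u^k P by 1 - uT, where T is a matrix of linear combinations of
creation operators, their adjoints and vertex projections. Removing the last edge of a path commutes
with T up to a rank one term at the vacuum vectors. Hence the vacuum coefficients of (1-uT)⁻¹
satisfy a closed polynomial system (`vacuumResolvent_eq`). Its Jacobian at u = 0 is the identity, so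
by the Jacobian criterion the coefficients are algebraic functions. The algebraic relation continues
analytically along [0,∞), and an algebraic function that converges at infinity, here to ν({0}), does
so at a polynomial rate.

No atom at zero. The operators `rightOp` commute with the algebra, each vacuum vector is separating
for their commutant, and the trace is cyclic when one factor lies in the algebra and the other in
the commutant. Cyclicity gives a rank-nullity principle (`exists_star_apply_eq_zero`): if P maps the
corner at x to the corner at y, μ x ≤ μ y, and P w = 0 for a nonzero w in the commutant supported at
x, then P* kills some ξ with a component at the vacuum of y. Commuting P with the removal of a last
edge and pairing with ξ is a free difference quotient; it produces a relation of the same kind in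
lower degree. Induction on the degree (`eq_zero_of_mul_eq_zero_of_mem_degreeLT`) forces P = 0.
Minimality of μ x is needed because the induction visits corners at other vertices y. Applied to the
kernel projection of P, this shows that the vacuum at x is orthogonal to the kernel. -/

theorem Derivation.map_mvPolynomial_aeval {R A M σ : Type*} [CommRing R] [CommRing A] [Algebra R A]
    [AddCommGroup M] [Module R M] [Module A M] [Fintype σ] (D : Derivation R A M)
    (y : σ → A) (p : MvPolynomial σ R) :
    D (MvPolynomial.aeval y p) = ∑ k, MvPolynomial.aeval y (MvPolynomial.pderiv k p) • D (y k) := by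
  classical
  induction p using MvPolynomial.induction_on with
  | C a => simp
  | add p q hp hq => simp [hp, hq, add_smul, Finset.sum_add_distrib]
  | mul_X p n hp =>
    simp only [map_mul, Derivation.leibniz, hp, MvPolynomial.aeval_X, smul_eq_mul, map_add,
      add_smul, Finset.sum_add_distrib, Finset.smul_sum, smul_smul, MvPolynomial.pderiv_X]
    rw [add_comm, add_comm (∑ k, _)]
    congr 1
    rw [Finset.sum_eq_single n] <;> simp +contextual [eq_comm]

/-- Differentiating f j (x) = 0 gives a linear system for the Kähler differentials of the x k whose
matrix is the invertible Jacobian, so these differentials vanish. The field F generated by the x k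
then has no differentials over K; being essentially of finite type, it is separable algebraic. -/
theorem isAlgebraic_of_jacobian_field {K L σ : Type*} [Field K] [CharZero K] [Field L] [Algebra K L]
    [Fintype σ] [DecidableEq σ] (x : σ → L) (f : σ → MvPolynomial σ K)
    (hf : ∀ j, MvPolynomial.aeval x (f j) = 0)
    (hdet : (Matrix.of fun j k => MvPolynomial.aeval x (MvPolynomial.pderiv k (f j))).det ≠ 0)
    (j : σ) : IsAlgebraic K (x j) := by
  let F := IntermediateField.adjoin K (Set.range x)
  let y : σ → F := fun i => ⟨x i, IntermediateField.subset_adjoin K _ ⟨i, rfl⟩⟩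
  have hy : ∀ p : MvPolynomial σ K, ((MvPolynomial.aeval y p : F) : L) = MvPolynomial.aeval x p := by
    intro p
    have := MvPolynomial.comp_aeval_apply (φ := F.val) y p
    exact this
  let M : Matrix σ σ F := Matrix.of fun j k => MvPolynomial.aeval y (MvPolynomial.pderiv k (f j))
  have hM : M.det ≠ 0 := by
    intro h
    apply hdet
    have := congrArg F.val h
    rw [map_zero, AlgHom.map_det] at this
    rw [← this]
    congr 1
    ext i k
    exact (hy _).symm
  have hDy : ∀ k, KaehlerDifferential.D K F (y k) = 0 := by
    intro k
    have h0 : ∀ i, ∑ l, M i l • KaehlerDifferential.D K F (y l) = 0 := by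
      intro i
      have h1 : MvPolynomial.aeval y (f i) = 0 := Subtype.ext (by rw [hy, hf]; rfl)
      have h2 := (KaehlerDifferential.D K F).map_mvPolynomial_aeval y (f i)
      rw [h1, map_zero] at h2
      exact h2.symm
    have h3 : M.det • KaehlerDifferential.D K F (y k) = 0 := by
      have h4 : ∑ i, M.adjugate k i • ∑ l, M i l • KaehlerDifferential.D K F (y l) = 0 :=
        Finset.sum_eq_zero fun i _ => by rw [h0, smul_zero]
      rw [← h4]
      -- Cramer's rule: multiplying the system by the adjugate isolates det M times one
      -- differential.
      simp only [Finset.smul_sum, smul_smul]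
      rw [Finset.sum_comm]
      simp only [← Finset.sum_smul]
      have h5 : ∀ l, ∑ i, M.adjugate k i * M i l = if k = l then M.det else 0 := by
        intro l
        rw [← Matrix.mul_apply, Matrix.adjugate_mul]
        simp [Matrix.one_apply]
      simp [h5]
    exact (smul_eq_zero.1 h3).resolve_left hM
  have hD : ∀ a : F, KaehlerDifferential.D K F a = 0 := by
    rintro ⟨a, ha⟩
    refine IntermediateField.adjoin_induction K
      (p := fun a ha => KaehlerDifferential.D K F ⟨a, ha⟩ = 0) ?_ ?_ ?_ ?_ ?_ ha
    · rintro _ ⟨i, rfl⟩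
      exact hDy i
    · intro c
      exact (KaehlerDifferential.D K F).map_algebraMap c
    · intro a b ha hb h1 h2
      have : (⟨a + b, add_mem ha hb⟩ : F) = ⟨a, ha⟩ + ⟨b, hb⟩ := rfl
      rw [this, map_add, h1, h2, add_zero]
    · intro a ha h1
      have : (⟨a⁻¹, inv_mem ha⟩ : F) = (⟨a, ha⟩ : F)⁻¹ := rfl
      rw [this, Derivation.leibniz_inv, h1, smul_zero]
    · intro a b ha hb h1 h2
      have : (⟨a * b, mul_mem ha hb⟩ : F) = ⟨a, ha⟩ * ⟨b, hb⟩ := rfl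
      rw [this, Derivation.leibniz, h1, h2, smul_zero, smul_zero, add_zero]
  have hsub : Subsingleton (Ω[F⁄K]) := by
    have h := KaehlerDifferential.span_range_derivation K F
    rw [← Submodule.subsingleton_iff F, ← subsingleton_iff_bot_eq_top, ← h, eq_comm,
      Submodule.span_eq_bot]
    rintro _ ⟨a, rfl⟩
    exact hD a
  have hess : Algebra.EssFiniteType K F :=
    IntermediateField.essFiniteType_iff.2
      (IntermediateField.fg_adjoin_of_finite (Set.finite_range x))
  have hunr : Algebra.FormallyUnramified K F := ⟨hsub⟩
  have hsep := (Algebra.FormallyUnramified.iff_isSeparable K F).1 hunr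
  have h := (hsep.isSeparable K (y j)).isIntegral.isAlgebraic
  exact (isAlgebraic_algebraMap_iff (A := L) (algebraMap F L).injective).2 h

/-- A solution of a square system of polynomial equations whose Jacobian determinant does not
vanish consists of algebraic elements. -/
theorem isAlgebraic_of_jacobian {A R σ : Type*} [CommRing A] [IsDomain A] [CharZero A] [CommRing R]
    [IsDomain R] [Algebra A R] [FaithfulSMul A R]
    [Fintype σ] [DecidableEq σ] (x : σ → R) (f : σ → MvPolynomial σ A)
    (hf : ∀ j, MvPolynomial.aeval x (f j) = 0)
    (hdet : (Matrix.of fun j k => MvPolynomial.aeval x (MvPolynomial.pderiv k (f j))).det ≠ 0)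
    (j : σ) : IsAlgebraic A (x j) := by
  let K := FractionRing A
  let L := FractionRing R
  let _ : Algebra K L := FractionRing.liftAlgebra A L
  have : IsScalarTower A K L := FractionRing.isScalarTower_liftAlgebra A L
  have hinj : Function.Injective (algebraMap R L) := IsFractionRing.injective R L
  have : CharZero K := IsFractionRing.charZero A
  have key : ∀ p : MvPolynomial σ A,
      MvPolynomial.aeval (fun i => algebraMap R L (x i)) (MvPolynomial.map (algebraMap A K) p) =
        algebraMap R L (MvPolynomial.aeval x p) := by
    intro p
    rw [MvPolynomial.aeval_map_algebraMap]
    exact MvPolynomial.aeval_algebraMap_apply L x p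
  have h := isAlgebraic_of_jacobian_field (K := K) (L := L) (fun i => algebraMap R L (x i))
    (fun i => MvPolynomial.map (algebraMap A K) (f i)) (fun i => by rw [key, hf, map_zero]) (by
      simp only [MvPolynomial.pderiv_map, key]
      intro h
      apply hdet
      apply hinj
      rw [map_zero, RingHom.map_det, ← h]
      rfl) j
  rw [← IsFractionRing.isAlgebraic_iff A K L] at h
  exact (isAlgebraic_algebraMap_iff hinj).1 h

/-! ### Analytic solutions of polynomial systems -/

/-- The restrictions to `U` of the functions that are analytic on a neighbourhood of `U`. -/
def analyticRestrictions (U : Set ℂ) : Subalgebra ℂ (U → ℂ) where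
  carrier := {f | ∃ F : ℂ → ℂ, AnalyticOnNhd ℂ F U ∧ ∀ x : U, f x = F x}
  mul_mem' := by
    rintro f g ⟨F, hF, hf⟩ ⟨G, hG, hg⟩
    exact ⟨F * G, hF.mul hG, fun x => by simp [hf, hg]⟩
  add_mem' := by
    rintro f g ⟨F, hF, hf⟩ ⟨G, hG, hg⟩
    exact ⟨F + G, hF.add hG, fun x => by simp [hf, hg]⟩
  algebraMap_mem' c := ⟨fun _ => c, analyticOnNhd_const, fun _ => rfl⟩

/-- By the identity theorem, if a product of analytic functions vanishes on a preconnected set then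
one factor vanishes there. -/
theorem analyticRestrictions.isDomain {U : Set ℂ} (hU : IsPreconnected U) (hne : U.Nonempty) :
    IsDomain (analyticRestrictions U) := by
  have : Nonempty U := hne.to_subtype
  have : NoZeroDivisors (analyticRestrictions U) := by
    refine ⟨?_⟩
    rintro ⟨f, F, hF, hf⟩ ⟨g, G, hG, hg⟩ h
    have h0 : ∀ z ∈ U, F z * G z = 0 := by
      intro z hz
      have := congrFun (congrArg Subtype.val h) ⟨z, hz⟩
      simpa [hf, hg] using this
    rcases hF.eq_zero_or_eq_zero_of_mul_eq_zero hG h0 hU with h1 | h1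
    · left
      ext x
      simpa [hf] using h1 x x.2
    · right
      ext x
      simpa [hg] using h1 x x.2
  exact NoZeroDivisors.to_isDomain _

open Polynomial in
/-- The linear combinations of an analytic solution near `0` of a system
`Φ j = c j + u * p j (u, Φ)` of polynomial equations are algebraic functions. -/
theorem exists_polynomial_of_analytic_system {σ : Type*} [Fintype σ] {δ : ℝ} (hδ : 0 < δ)
    (c : σ → ℂ) (p : σ → MvPolynomial σ ℂ[X]) (Φ : σ → ℂ → ℂ)
    (hΦ : ∀ j, AnalyticOnNhd ℂ (Φ j) (Metric.ball 0 δ))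
    (heq : ∀ j, ∀ u ∈ Metric.ball (0 : ℂ) δ, Φ j u =
      c j + u * MvPolynomial.eval₂ (evalRingHom u) (fun k => Φ k u) (p j)) (w : σ → ℂ) :
    ∃ Q : ℂ[X][X], Q ≠ 0 ∧ ∀ u ∈ Metric.ball (0 : ℂ) δ,
      Q.eval₂ (evalRingHom u) (∑ j, w j * Φ j u) = 0 := by
  classical
  let U := Metric.ball (0 : ℂ) δ
  have h0U : (0 : ℂ) ∈ U := Metric.mem_ball_self hδ
  have hdom : IsDomain (analyticRestrictions U) :=
    analyticRestrictions.isDomain (convex_ball _ _).isPreconnected ⟨0, h0U⟩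
  let ι : analyticRestrictions U := ⟨fun u => u, id, analyticOnNhd_id, fun _ => rfl⟩
  let _ : Algebra ℂ[X] (analyticRestrictions U) := (aeval ι).toRingHom.toAlgebra
  let ev : U → analyticRestrictions U →+* ℂ := fun u =>
    (Pi.evalRingHom (fun _ : U => ℂ) u).comp (analyticRestrictions U).val.toRingHom
  have hev : ∀ u : U, (ev u).comp (algebraMap ℂ[X] (analyticRestrictions U)) =
      evalRingHom (u : ℂ) := by
    intro u
    ext a
    · simp only [RingHom.comp_apply]
      change ev u (aeval ι (C a)) = _
      rw [aeval_C]
      simp [ev]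
    · simp only [RingHom.comp_apply]
      change ev u (aeval ι X) = _
      rw [aeval_X]
      simp [ev, ι]
  have hfaith : FaithfulSMul ℂ[X] (analyticRestrictions U) := by
    rw [faithfulSMul_iff_algebraMap_injective, injective_iff_map_eq_zero]
    intro q hq
    refine eq_zero_of_infinite_isRoot q (Set.Infinite.mono (s := U) ?_ ?_)
    · intro u hu
      have h := congrArg (ev ⟨u, hu⟩) hq
      rw [map_zero, ← RingHom.comp_apply, hev] at h
      exact h
    · exact (infinite_of_mem_nhds (0 : ℂ) (Metric.ball_mem_nhds _ hδ))
  let x : σ → analyticRestrictions U := fun j => ⟨fun u => Φ j u, Φ j, hΦ j, fun _ => rfl⟩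
  have hx : ∀ (q : MvPolynomial σ ℂ[X]) (u : U), ev u (MvPolynomial.aeval x q) =
      MvPolynomial.eval₂ (evalRingHom (u : ℂ)) (fun k => Φ k u) q := by
    intro q u
    rw [MvPolynomial.aeval_def, MvPolynomial.eval₂_comp_left, hev]
    rfl
  let f : σ → MvPolynomial σ ℂ[X] := fun j =>
    MvPolynomial.X j - MvPolynomial.C (C (c j)) - MvPolynomial.C X * p j
  have hf : ∀ j, MvPolynomial.aeval x (f j) = 0 := by
    intro j
    apply Subtype.ext
    funext u
    change ev u (MvPolynomial.aeval x (f j)) = 0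
    rw [hx]
    simp only [f, MvPolynomial.eval₂_sub, MvPolynomial.eval₂_X, MvPolynomial.eval₂_C,
      MvPolynomial.eval₂_mul, coe_evalRingHom, eval_C, eval_X]
    rw [heq j u u.2]
    ring
  -- The determinant is an analytic function of u, so it is enough to see that it is nonzero at u =
  -- 0. There the term u * p j contributes nothing and the Jacobian is the identity.
  have hdet : (Matrix.of fun j k =>
      MvPolynomial.aeval x (MvPolynomial.pderiv k (f j))).det ≠ 0 := by
    intro h
    have h1 := congrArg (ev ⟨0, h0U⟩) h
    rw [map_zero, RingHom.map_det] at h1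
    have h2 : (ev ⟨0, h0U⟩).mapMatrix (Matrix.of fun j k =>
      MvPolynomial.aeval x (MvPolynomial.pderiv k (f j))) = 1 := by
      ext j k
      rw [RingHom.mapMatrix_apply, Matrix.map_apply, Matrix.of_apply, hx]
      simp only [f, map_sub, MvPolynomial.pderiv_C, Derivation.leibniz, MvPolynomial.pderiv_X,
        smul_eq_mul, mul_zero, add_zero, sub_zero, MvPolynomial.eval₂_sub, MvPolynomial.eval₂_mul,
        MvPolynomial.eval₂_C, coe_evalRingHom, eval_X, zero_mul]
      rw [Matrix.one_apply, Pi.single_apply]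
      simp only [eq_comm]
      split_ifs <;> simp
    rw [h2, Matrix.det_one] at h1
    exact one_ne_zero h1
  have halg : ∀ j, IsAlgebraic ℂ[X] (x j) := isAlgebraic_of_jacobian x f hf hdet
  have hsum : IsAlgebraic ℂ[X] (∑ j, algebraMap ℂ[X] (analyticRestrictions U) (C (w j)) * x j) :=
    Finset.sum_induction _ (IsAlgebraic ℂ[X]) (fun _ _ => IsAlgebraic.add) isAlgebraic_zero
      fun j _ => (isAlgebraic_algebraMap _).mul (halg j)
  obtain ⟨Q, hQ, hQ0⟩ := hsum
  refine ⟨Q, hQ, fun u hu => ?_⟩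
  have h := congrArg (ev ⟨u, hu⟩) hQ0
  rw [map_zero, aeval_def, hom_eval₂, hev] at h
  rw [← h]
  congr 1
  rw [map_sum]
  refine Finset.sum_congr rfl fun j _ => ?_
  rw [map_mul, ← RingHom.comp_apply, hev]
  simp [x, ev]

/-! ### Coordinates on the Fock space -/

namespace FreeGraph

section Pullback

variable {I : Type*} (τ : I → Option I) (hτ : ∀ i j k, τ i = some k → τ j = some k → i = j)

theorem pullback_apply (f : L2 I) (i : I) : pullback τ hτ f i = (τ i).elim 0 f := rfl

open Classical in
theorem adjoint_pullback_apply (f : L2 I) (k : I) :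
    ContinuousLinearMap.adjoint (pullback τ hτ) f k =
      inner ℂ (pullback τ hτ (lp.single 2 k 1)) f := by
  rw [← ContinuousLinearMap.adjoint_inner_right, lp.inner_single_left]
  simp

open Classical in
theorem adjoint_pullback_apply_of_eq (f : L2 I) {i k : I} (h : τ i = some k) :
    ContinuousLinearMap.adjoint (pullback τ hτ) f k = f i := by
  have : pullback τ hτ (lp.single 2 k 1) = lp.single 2 i 1 := by
    apply lp.ext
    funext j
    rw [pullback_apply, lp.single_apply]
    by_cases hj : j = i
    · subst hj
      simp [h, lp.single_apply]
    · rw [Pi.single_eq_of_ne hj]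
      cases hj' : τ j with
      | none => rfl
      | some m =>
        have : m ≠ k := by
          rintro rfl
          exact hj (hτ j i m hj' h)
        simp [lp.single_apply, this]
  rw [adjoint_pullback_apply, this, lp.inner_single_left]
  simp

open Classical in
theorem adjoint_pullback_apply_of_ne (f : L2 I) {k : I} (h : ∀ i, τ i ≠ some k) :
    ContinuousLinearMap.adjoint (pullback τ hτ) f k = 0 := by
  have : pullback τ hτ (lp.single 2 k 1) = 0 := by
    apply lp.ext
    funext j
    rw [pullback_apply]
    cases hj' : τ j with
    | none => rfl
    | some m =>
      have : m ≠ k := by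
        rintro rfl
        exact h j hj'
      simp [lp.single_apply, this]
  rw [adjoint_pullback_apply, this, inner_zero_left]

end Pullback

universe u v

variable {V : Type u} {E : Type v} {G : Graph V E}

theorem IsPathFrom.of_append {x : V(G)} {l m : List (OEdge G)} (h : IsPathFrom x (l ++ m)) :
    IsPathFrom x l := by
  induction l generalizing x with
  | nil => trivial
  | cons d l ih => exact ⟨h.1, ih h.2⟩

@[simp]
theorem OEdge.op_op (ε : OEdge G) : ε.op.op = ε := rfl

@[simp]
theorem OEdge.src_op (ε : OEdge G) : ε.op.src = ε.tgt := rfl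

@[simp]
theorem OEdge.tgt_op (ε : OEdge G) : ε.op.tgt = ε.src := rfl

theorem OEdge.op_eq_iff {ε d : OEdge G} : ε.op = d ↔ ε = d.op := by
  constructor <;> rintro rfl <;> rfl

instance [Finite V(G)] [Finite E(G)] : Finite (OEdge G) := by
  let f : OEdge G → E(G) × V(G) × V(G) := fun ε => (⟨ε.edge, ε.isLink.edge_mem⟩, ε.src, ε.tgt)
  refine Finite.of_injective f fun ε d h => ?_
  simp only [f, Prod.mk.injEq, Subtype.mk.injEq] at h
  exact OEdge.ext h.1 h.2.1 h.2.2

theorem isPathFrom_nil (x : V(G)) : IsPathFrom x [] := trivial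

/-- The path that starts at `x` and runs through the edges in `l`. -/
def DPath.mk {x : V(G)} {l : List (OEdge G)} (h : IsPathFrom x l) : DPath G := ⟨(x, l), h⟩

theorem DPath.mk_surjective (p : DPath G) : ∃ x l, ∃ h : IsPathFrom x l, p = DPath.mk h :=
  ⟨p.1.1, p.1.2, p.2, rfl⟩

theorem DPath.mk_eq_mk_iff {x y : V(G)} {l m : List (OEdge G)} {h : IsPathFrom x l}
    {h' : IsPathFrom y m} : DPath.mk h = DPath.mk h' ↔ x = y ∧ l = m :=
  ⟨fun e => ⟨congrArg (fun p : DPath G => p.1.1) e, congrArg (fun p : DPath G => p.1.2) e⟩,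
    fun ⟨e1, e2⟩ => by subst e1; subst e2; rfl⟩

open Classical in
theorem DPath.strip_mk_cons {x : V(G)} {d : OEdge G} {l : List (OEdge G)}
    (h : IsPathFrom x (d :: l)) (ε : OEdge G) :
    DPath.strip ε (DPath.mk h) = if d = ε then some (DPath.mk h.2) else none := rfl

open Classical in
theorem DPath.at_mk {x : V(G)} {l : List (OEdge G)} (h : IsPathFrom x l) (y : V(G)) :
    DPath.at y (DPath.mk h) = if x = y then some (DPath.mk h) else none := rfl

open Classical in
/-- The coordinate of a vector at the path that starts at `x` and runs through the edges in `l`,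
zero if there is no such path. -/
def pathCoeff (x : V(G)) (l : List (OEdge G)) : Fock G →L[ℂ] ℂ :=
  if h : IsPathFrom x l then innerSL ℂ (lp.single 2 (DPath.mk h) 1) else 0

theorem pathCoeff_of_path {x : V(G)} {l : List (OEdge G)} (h : IsPathFrom x l) (f : Fock G) :
    pathCoeff x l f = f (DPath.mk h) := by
  classical
  rw [pathCoeff, dif_pos h, innerSL_apply_apply, lp.inner_single_left]
  simp

theorem pathCoeff_of_not {x : V(G)} {l : List (OEdge G)} (h : ¬ IsPathFrom x l) (f : Fock G) :
    pathCoeff x l f = 0 := by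
  rw [pathCoeff, dif_neg h]
  rfl

theorem ext_pathCoeff {f g : Fock G} (h : ∀ x l, pathCoeff x l f = pathCoeff x l g) : f = g := by
  apply lp.ext
  funext p
  obtain ⟨x, l, hp, rfl⟩ := p.mk_surjective
  rw [← pathCoeff_of_path hp, ← pathCoeff_of_path hp, h]

theorem inner_vac (x : V(G)) (f : Fock G) : inner ℂ (vac x) f = pathCoeff x [] f := by
  classical
  rw [pathCoeff_of_path (isPathFrom_nil x), vac, lp.inner_single_left]
  simp only [map_one, RCLike.inner_apply, mul_one]
  rfl

open Classical in
theorem pathCoeff_vac (x y : V(G)) (l : List (OEdge G)) :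
    pathCoeff x l (vac y) = if x = y ∧ l = [] then 1 else 0 := by
  by_cases h : IsPathFrom x l
  · have : DPath.nil y = DPath.mk (isPathFrom_nil y) := rfl
    rw [pathCoeff_of_path h, vac, lp.single_apply, Pi.single_apply, this]
    simp only [DPath.mk_eq_mk_iff]
  · rw [pathCoeff_of_not h, if_neg]
    rintro ⟨-, rfl⟩
    exact h trivial

open Classical in
theorem pathCoeff_vproj (x y : V(G)) (l : List (OEdge G)) (f : Fock G) :
    pathCoeff x l (vproj y f) = if x = y then pathCoeff x l f else 0 := by
  by_cases h : IsPathFrom x l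
  · rw [pathCoeff_of_path h, pathCoeff_of_path h, vproj, pullback_apply, DPath.at_mk]
    split_ifs <;> rfl
  · simp [pathCoeff_of_not h]

@[simp]
theorem pathCoeff_nil_creation (x : V(G)) (ε : OEdge G) (f : Fock G) :
    pathCoeff x [] (creation ε f) = 0 := by
  rw [pathCoeff_of_path (isPathFrom_nil x), creation, pullback_apply]
  rfl

open Classical in
theorem pathCoeff_cons_creation (x : V(G)) (d : OEdge G) (l : List (OEdge G)) (ε : OEdge G)
    (f : Fock G) : pathCoeff x (d :: l) (creation ε f) =
      if d = ε ∧ x = ε.src then pathCoeff ε.tgt l f else 0 := by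
  by_cases h : IsPathFrom x (d :: l)
  · rw [pathCoeff_of_path h, creation, pullback_apply, DPath.strip_mk_cons]
    by_cases hd : d = ε
    · subst hd
      rw [if_pos rfl, if_pos ⟨rfl, h.1.symm⟩, pathCoeff_of_path h.2]
      rfl
    · rw [if_neg hd, if_neg fun h => hd h.1]
      rfl
  · rw [pathCoeff_of_not h]
    split_ifs with h1
    · obtain ⟨rfl, rfl⟩ := h1
      rw [pathCoeff_of_not]
      exact fun h2 => h ⟨rfl, h2⟩
    · rfl

open Classical in
theorem pathCoeff_adjoint_creation (x : V(G)) (l : List (OEdge G)) (ε : OEdge G) (f : Fock G) :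
    pathCoeff x l (ContinuousLinearMap.adjoint (creation ε) f) =
      if x = ε.tgt then pathCoeff ε.src (ε :: l) f else 0 := by
  by_cases h : IsPathFrom x l
  · rw [pathCoeff_of_path h, creation]
    by_cases hx : x = ε.tgt
    · have h' : IsPathFrom ε.src (ε :: l) := ⟨rfl, hx ▸ h⟩
      rw [if_pos hx, pathCoeff_of_path h']
      refine adjoint_pullback_apply_of_eq _ _ f ?_
      exact (DPath.strip_eq_some_iff _ _ _).2 ⟨hx, rfl⟩
    · rw [if_neg hx]
      refine adjoint_pullback_apply_of_ne _ _ f fun i hi => ?_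
      obtain ⟨hi, -⟩ := (DPath.strip_eq_some_iff _ _ _).1 hi
      exact hx hi
  · rw [pathCoeff_of_not h]
    split_ifs with hx
    · rw [pathCoeff_of_not]
      exact fun h2 => h (hx ▸ h2.2)
    · rfl

open Classical in
/-- Puts the edge `ε` at the end of a path; undefined if the result is not a path. -/
def DPath.snoc (ε : OEdge G) (q : DPath G) : Option (DPath G) :=
  if h : IsPathFrom q.1.1 (q.1.2 ++ [ε]) then some ⟨(q.1.1, q.1.2 ++ [ε]), h⟩ else none

open Classical in
theorem DPath.snoc_mk {x : V(G)} {l : List (OEdge G)} (h : IsPathFrom x l) (ε : OEdge G) :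
    DPath.snoc ε (DPath.mk h) =
      if h' : IsPathFrom x (l ++ [ε]) then some (DPath.mk h') else none := rfl

theorem DPath.snoc_eq_some {ε : OEdge G} {q p : DPath G} (h : DPath.snoc ε q = some p) :
    p.1.1 = q.1.1 ∧ p.1.2 = q.1.2 ++ [ε] := by
  rw [DPath.snoc] at h
  split_ifs at h
  cases h
  exact ⟨rfl, rfl⟩

/-- The operator that removes the edge `ε` from the end of a path and kills all paths that do not
end with `ε`. -/
def rightAnn (ε : OEdge G) : Fock G →L[ℂ] Fock G :=
  pullback (DPath.snoc ε) (by
    intro p q r hp hq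
    have h1 := DPath.snoc_eq_some hp
    have h2 := DPath.snoc_eq_some hq
    apply Subtype.ext
    apply Prod.ext
    · rw [← h1.1, h2.1]
    · exact List.append_cancel_right (h1.2.symm.trans h2.2))

theorem DPath.snoc_eq_mk {ε : OEdge G} {q : DPath G} {x : V(G)} {l : List (OEdge G)}
    {h : IsPathFrom x l} (hq : DPath.snoc ε q = some (DPath.mk h)) : l = q.1.2 ++ [ε] :=
  (DPath.snoc_eq_some hq).2

theorem rightAnn_apply (ε : OEdge G) (f : Fock G) (p : DPath G) :
    rightAnn ε f p = (DPath.snoc ε p).elim 0 f := rfl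

@[simp]
theorem pathCoeff_rightAnn (x : V(G)) (l : List (OEdge G)) (ε : OEdge G) (f : Fock G) :
    pathCoeff x l (rightAnn ε f) = pathCoeff x (l ++ [ε]) f := by
  by_cases h : IsPathFrom x (l ++ [ε])
  · rw [pathCoeff_of_path h, pathCoeff_of_path h.of_append, rightAnn_apply, DPath.snoc_mk,
      dif_pos h]
    rfl
  · rw [pathCoeff_of_not h]
    by_cases h' : IsPathFrom x l
    · rw [pathCoeff_of_path h', rightAnn_apply, DPath.snoc_mk, dif_neg h]
      rfl
    · rw [pathCoeff_of_not h']

theorem pathCoeff_nil_adjoint_rightAnn (x : V(G)) (ε : OEdge G) (f : Fock G) :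
    pathCoeff x [] (ContinuousLinearMap.adjoint (rightAnn ε) f) = 0 := by
  rw [pathCoeff_of_path (isPathFrom_nil x), rightAnn]
  refine adjoint_pullback_apply_of_ne _ _ f fun i hi => ?_
  simpa using DPath.snoc_eq_mk hi

open Classical in
theorem pathCoeff_append_adjoint_rightAnn (x : V(G)) (l : List (OEdge G)) (d ε : OEdge G)
    (f : Fock G) : pathCoeff x (l ++ [d]) (ContinuousLinearMap.adjoint (rightAnn ε) f) =
      if d = ε ∧ IsPathFrom x (l ++ [ε]) then pathCoeff x l f else 0 := by
  by_cases h : IsPathFrom x (l ++ [d])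
  · rw [pathCoeff_of_path h, rightAnn]
    split_ifs with h1
    · obtain ⟨rfl, h1⟩ := h1
      rw [pathCoeff_of_path h.of_append]
      refine adjoint_pullback_apply_of_eq _ _ f ?_
      rw [DPath.snoc_mk, dif_pos h1]
    · refine adjoint_pullback_apply_of_ne _ _ f fun i hi => ?_
      have h2 := DPath.snoc_eq_mk hi
      rw [List.append_singleton_inj] at h2
      exact h1 ⟨h2.2, h2.2 ▸ h⟩
  · rw [pathCoeff_of_not h, if_neg]
    rintro ⟨rfl, h1⟩
    exact h h1

@[simp]
theorem rightAnn_vac (ε : OEdge G) (x : V(G)) : rightAnn ε (vac x) = 0 := by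
  apply ext_pathCoeff
  intro y l
  simp [pathCoeff_vac]

theorem rightAnn_vproj (ε : OEdge G) (x : V(G)) (f : Fock G) :
    rightAnn ε (vproj x f) = vproj x (rightAnn ε f) := by
  apply ext_pathCoeff
  intro y l
  simp [pathCoeff_vproj]

theorem rightAnn_adjoint_creation (ε d : OEdge G) (f : Fock G) :
    rightAnn ε (ContinuousLinearMap.adjoint (creation d) f) =
      ContinuousLinearMap.adjoint (creation d) (rightAnn ε f) := by
  apply ext_pathCoeff
  intro y l
  simp [pathCoeff_adjoint_creation]

open Classical in
-- Adding a first edge and removing a last one are independent, except on a path of length zero,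
-- where the edge just added is also the last one. The adjoint of a creation operator has no such
-- exception: both orders read the coefficient at a path with one more edge at each end.
theorem rightAnn_creation (ε d : OEdge G) (f : Fock G) :
    rightAnn ε (creation d f) = creation d (rightAnn ε f) +
      if d = ε then pathCoeff ε.tgt [] f • vac ε.src else 0 := by
  apply ext_pathCoeff
  intro y l
  rw [map_add, pathCoeff_rightAnn]
  cases l with
  | nil =>
    rw [List.nil_append, pathCoeff_cons_creation, pathCoeff_nil_creation, zero_add]
    by_cases h : d = ε
    · subst h
      simp [pathCoeff_vac]
    · simp [h, Ne.symm h]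
  | cons c l =>
    rw [List.cons_append, pathCoeff_cons_creation, pathCoeff_cons_creation, pathCoeff_rightAnn]
    split_ifs <;> simp [pathCoeff_vac]

end FreeGraph

/-! ### Linear pencils in creation and annihilation operators -/

namespace FreeGraph

universe u v

variable {V : Type u} {E : Type v} {G : Graph V E}

/-- The creation operators, their adjoints, and the vertex projections. -/
def fockOp : OEdge G ⊕ OEdge G ⊕ V(G) → (Fock G →L[ℂ] Fock G) :=
  Sum.elim creation (Sum.elim (fun ε => ContinuousLinearMap.adjoint (creation ε)) vproj)

variable [Fintype (OEdge G)] [Fintype V(G)]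

/-- A linear combination of the creation operators, their adjoints, and the vertex projections. -/
def fockSum (t : OEdge G ⊕ OEdge G ⊕ V(G) → ℂ) : Fock G →L[ℂ] Fock G := ∑ g, t g • fockOp g

open Classical in
-- Creation operators never reach a path of length zero. An annihilator reads the coordinate at a
-- one-edge path, and this edge can equally be removed from the right, which lets `rightAnn` enter.
theorem pathCoeff_nil_fockSum (t : OEdge G ⊕ OEdge G ⊕ V(G) → ℂ) (x : V(G)) (f : Fock G) :
    pathCoeff x [] (fockSum t f) = t (.inr (.inr x)) * pathCoeff x [] f +
      ∑ ε : OEdge G with ε.tgt = x,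
        t (.inr (.inl ε)) * pathCoeff ε.src [] (rightAnn ε f) := by
  simp only [fockSum, Fintype.sum_sum_type, fockOp, Sum.elim_inl, Sum.elim_inr, map_add, map_sum,
    add_apply, sum_apply, smul_apply, map_smul, pathCoeff_nil_creation, pathCoeff_vproj,
    pathCoeff_adjoint_creation, smul_eq_mul, mul_ite, mul_zero, Finset.sum_const_zero, zero_add,
    Finset.sum_ite_eq, Finset.mem_univ, if_true, Finset.sum_filter, pathCoeff_rightAnn,
    List.nil_append]
  rw [add_comm]
  simp only [eq_comm]

theorem rightAnn_fockSum (t : OEdge G ⊕ OEdge G ⊕ V(G) → ℂ) (ε : OEdge G) (f : Fock G) :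
    rightAnn ε (fockSum t f) =
      fockSum t (rightAnn ε f) + (t (.inl ε) * pathCoeff ε.tgt [] f) • vac ε.src := by
  classical
  simp only [fockSum, Fintype.sum_sum_type, fockOp, Sum.elim_inl, Sum.elim_inr, map_add, map_sum,
    add_apply, sum_apply, smul_apply, map_smul, rightAnn_vproj,
    rightAnn_adjoint_creation, rightAnn_creation, smul_add, Finset.sum_add_distrib]
  simp [smul_smul]
  abel

variable {ι : Type*} [Fintype ι]

/-- The operator on tuples of vectors that is given by a matrix of linear combinations of the
creation operators, their adjoints, and the vertex projections. -/
def pencil (t : ι → ι → OEdge G ⊕ OEdge G ⊕ V(G) → ℂ) : (ι → Fock G) →L[ℂ] (ι → Fock G) :=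
  ContinuousLinearMap.pi fun i => ∑ k, fockSum (t i k) ∘L ContinuousLinearMap.proj k

theorem pencil_apply (t : ι → ι → OEdge G ⊕ OEdge G ⊕ V(G) → ℂ) (ψ : ι → Fock G) (i : ι) :
    pencil t ψ i = ∑ k, fockSum (t i k) (ψ k) := by
  simp [pencil]

/-- The resolvent of a linear pencil. -/
def pencilInv (t : ι → ι → OEdge G ⊕ OEdge G ⊕ V(G) → ℂ) (u : ℂ) :
    (ι → Fock G) →L[ℂ] (ι → Fock G) := Ring.inverse (1 - u • pencil t)

theorem isUnit_one_sub_pencil (t : ι → ι → OEdge G ⊕ OEdge G ⊕ V(G) → ℂ) {u : ℂ}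
    (hu : u ∈ Metric.ball (0 : ℂ) (‖pencil t‖ + 1)⁻¹) : IsUnit (1 - u • pencil t) := by
  apply isUnit_one_sub_of_norm_lt_one
  rw [mem_ball_zero_iff] at hu
  have h0 : 0 < ‖pencil t‖ + 1 := by positivity
  rw [norm_smul]
  calc ‖u‖ * ‖pencil t‖ ≤ ‖u‖ * (‖pencil t‖ + 1) := by gcongr; linarith
    _ < (‖pencil t‖ + 1)⁻¹ * (‖pencil t‖ + 1) := by gcongr
    _ = 1 := inv_mul_cancel₀ h0.ne'

theorem eq_pencilInv {t : ι → ι → OEdge G ⊕ OEdge G ⊕ V(G) → ℂ} {u : ℂ}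
    (hu : IsUnit (1 - u • pencil t)) {ψ e : ι → Fock G} (h : ψ = e + u • pencil t ψ) :
    ψ = pencilInv t u e := by
  have h1 : (1 - u • pencil t) ψ = e := by
    rw [sub_apply, one_apply_eq_self, smul_apply, sub_eq_iff_eq_add]
    exact h
  rw [← h1, pencilInv, ← mul_apply_eq_comp, Ring.inverse_mul_cancel _ hu,
    one_apply_eq_self]

theorem pencilInv_eq {t : ι → ι → OEdge G ⊕ OEdge G ⊕ V(G) → ℂ} {u : ℂ}
    (hu : IsUnit (1 - u • pencil t)) (e : ι → Fock G) :
    pencilInv t u e = e + u • pencil t (pencilInv t u e) := by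
  have h1 : (1 - u • pencil t) (pencilInv t u e) = e := by
    rw [pencilInv, ← mul_apply_eq_comp, Ring.mul_inverse_cancel _ hu,
      one_apply_eq_self]
  rw [sub_apply, one_apply_eq_self, smul_apply, sub_eq_iff_eq_add] at h1
  exact h1

variable [DecidableEq ι]

/-- The vacuum expectation of the resolvent of a linear pencil. -/
def vacuumResolvent (t : ι → ι → OEdge G ⊕ OEdge G ⊕ V(G) → ℂ) (j : V(G) × ι × ι) (u : ℂ) : ℂ :=
  pathCoeff j.1 [] (pencilInv t u (Pi.single j.2.2 (vac j.1)) j.2.1)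

theorem analyticOnNhd_vacuumResolvent (t : ι → ι → OEdge G ⊕ OEdge G ⊕ V(G) → ℂ)
    (j : V(G) × ι × ι) :
    AnalyticOnNhd ℂ (vacuumResolvent t j) (Metric.ball 0 (‖pencil t‖ + 1)⁻¹) := by
  intro u hu
  have h1 : AnalyticAt ℂ (fun u : ℂ => 1 - u • pencil t) u :=
    analyticAt_const.sub (analyticAt_id.smul analyticAt_const)
  have h2 : AnalyticAt ℂ (Ring.inverse : ((ι → Fock G) →L[ℂ] (ι → Fock G)) → _)
      (1 - u • pencil t) := by
    obtain ⟨z, hz⟩ := isUnit_one_sub_pencil t hu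
    rw [← hz]
    exact analyticAt_inverse z
  have h3 : AnalyticAt ℂ (pencilInv t) u := AnalyticAt.fun_comp (f := fun u : ℂ => 1 - u • pencil t) h2 h1
  let Λ : ((ι → Fock G) →L[ℂ] (ι → Fock G)) →L[ℂ] ℂ :=
    (pathCoeff j.1 []) ∘L (ContinuousLinearMap.proj j.2.1) ∘L
      (ContinuousLinearMap.apply ℂ (ι → Fock G) (Pi.single j.2.2 (vac j.1)))
  exact (Λ.analyticAt _).fun_comp h3

/-- Applying `rightAnn ε` to the resolvent equation gives a resolvent equation for the same pencil,
whose source is now a multiple of the vacuum at `ε.src`, with coefficients that are vacuum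
coefficients themselves. By uniqueness the one-edge coefficients are quadratic in the vacuum
coefficients. -/
theorem pathCoeff_rightAnn_pencilInv {t : ι → ι → OEdge G ⊕ OEdge G ⊕ V(G) → ℂ} {u : ℂ}
    (hu : IsUnit (1 - u • pencil t)) (ε : OEdge G) (k j : ι) :
    pathCoeff ε.src [] (rightAnn ε (pencilInv t u (Pi.single j (vac ε.tgt)) k)) =
      ∑ l, vacuumResolvent t (ε.src, k, l) u *
        (u * ∑ m, t l m (.inl ε) * vacuumResolvent t (ε.tgt, m, j) u) := by
  set ψ := pencilInv t u (Pi.single j (vac ε.tgt)) with hψ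
  let c : ι → ℂ := fun l => u * ∑ m, t l m (.inl ε) * vacuumResolvent t (ε.tgt, m, j) u
  have h : (fun i => rightAnn ε (ψ i)) = (fun i => c i • vac ε.src) +
      u • pencil t (fun i => rightAnn ε (ψ i)) := by
    funext i
    rw [Pi.add_apply, Pi.smul_apply, pencil_apply]
    conv_lhs => rw [hψ, pencilInv_eq hu, ← hψ, Pi.add_apply, Pi.smul_apply, pencil_apply]
    rw [map_add, map_smul, map_sum]
    simp only [rightAnn_fockSum, Finset.sum_add_distrib, smul_add, ← Finset.sum_smul, smul_smul]
    have : rightAnn ε (Pi.single (M := fun _ => Fock G) j (vac ε.tgt) i) = 0 := by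
      rw [Pi.single_apply]
      split_ifs <;> simp
    rw [this, zero_add, add_comm]
    rfl
  have h2 := eq_pencilInv hu h
  have h3 : (fun i => c i • vac ε.src) =
      ∑ l, c l • (Pi.single l (vac ε.src) : ι → Fock G) := by
    funext i
    simp [Finset.sum_apply, Pi.single_apply]
  rw [h3, map_sum] at h2
  have h4 := congrArg (pathCoeff ε.src []) (congrFun h2 k)
  refine h4.trans ?_
  simp only [map_smul, Finset.sum_apply, map_sum, Pi.smul_apply, smul_eq_mul]
  exact Finset.sum_congr rfl fun l _ => mul_comm _ _

open Classical in
-- This is the closed system: the vacuum component of the resolvent equation, with the one-edge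
-- coefficients eliminated by `pathCoeff_rightAnn_pencilInv`. The factor u in front of everything
-- but the constant is what makes the Jacobian trivial at u = 0.
theorem vacuumResolvent_eq {t : ι → ι → OEdge G ⊕ OEdge G ⊕ V(G) → ℂ} {u : ℂ}
    (hu : IsUnit (1 - u • pencil t)) (x : V(G)) (i j : ι) :
    vacuumResolvent t (x, i, j) u = (if i = j then 1 else 0) +
      u * ∑ k, (t i k (.inr (.inr x)) * vacuumResolvent t (x, k, j) u +
        ∑ ε : OEdge G with ε.tgt = x, t i k (.inr (.inl ε)) *
          ∑ l, vacuumResolvent t (ε.src, k, l) u *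
            (u * ∑ m, t l m (.inl ε) * vacuumResolvent t (x, m, j) u)) := by
  have h := pencilInv_eq hu (Pi.single j (vac x))
  have h1 := congrArg (pathCoeff x []) (congrFun h i)
  rw [vacuumResolvent]
  refine h1.trans ?_
  rw [Pi.add_apply, Pi.smul_apply, map_add, map_smul, pencil_apply, map_sum, smul_eq_mul]
  congr 1
  · rw [Pi.single_apply]
    split_ifs <;> simp [pathCoeff_vac]
  · congr 1
    refine Finset.sum_congr rfl fun k _ => ?_
    rw [pathCoeff_nil_fockSum]
    congr 1
    refine Finset.sum_congr rfl fun ε hε => ?_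
    congr 1
    obtain rfl := (Finset.mem_filter.1 hε).2
    exact pathCoeff_rightAnn_pencilInv hu ε k j

open Polynomial in
/-- The linear combinations of the vacuum expectations of the resolvent of a linear pencil are
algebraic functions. -/
theorem exists_polynomial_vacuumResolvent (t : ι → ι → OEdge G ⊕ OEdge G ⊕ V(G) → ℂ)
    (w : V(G) × ι × ι → ℂ) :
    ∃ Q : ℂ[X][X], Q ≠ 0 ∧ ∀ u ∈ Metric.ball (0 : ℂ) (‖pencil t‖ + 1)⁻¹,
      Q.eval₂ (evalRingHom u) (∑ j, w j * vacuumResolvent t j u) = 0 := by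
  classical
  have hδ : 0 < (‖pencil t‖ + 1)⁻¹ := by positivity
  refine exists_polynomial_of_analytic_system hδ (fun j => if j.2.1 = j.2.2 then 1 else 0)
    (fun j => ∑ k, (MvPolynomial.C (C (t j.2.1 k (.inr (.inr j.1)))) *
        MvPolynomial.X (j.1, k, j.2.2) +
      ∑ ε : OEdge G with ε.tgt = j.1, MvPolynomial.C (C (t j.2.1 k (.inr (.inl ε)))) *
        ∑ l, MvPolynomial.X (ε.src, k, l) * (MvPolynomial.C X *
          ∑ m, MvPolynomial.C (C (t l m (.inl ε))) * MvPolynomial.X (j.1, m, j.2.2))))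
    (vacuumResolvent t) (analyticOnNhd_vacuumResolvent t) ?_ w
  rintro ⟨x, i, j⟩ u hu
  rw [vacuumResolvent_eq (isUnit_one_sub_pencil t hu)]
  simp only [MvPolynomial.eval₂_sum, MvPolynomial.eval₂_add, MvPolynomial.eval₂_mul,
    MvPolynomial.eval₂_C, MvPolynomial.eval₂_X, coe_evalRingHom, eval_C, eval_X]

end FreeGraph

/-! ### Linearization of polynomials -/

namespace FreeGraph

universe u v

variable {V : Type u} {E : Type v} {G : Graph V E}

/-- The product of the operators listed in a word. -/
def wordOp (l : List (OEdge G ⊕ OEdge G ⊕ V(G))) : Fock G →L[ℂ] Fock G := (l.map fockOp).prod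

theorem wordOp_cons (g : OEdge G ⊕ OEdge G ⊕ V(G)) (l : List (OEdge G ⊕ OEdge G ⊕ V(G))) :
    wordOp (g :: l) = fockOp g * wordOp l := by
  simp [wordOp]

theorem wordOp_append (l m : List (OEdge G ⊕ OEdge G ⊕ V(G))) :
    wordOp (l ++ m) = wordOp l * wordOp m := by
  simp [wordOp]

variable (G) in
/-- The linear combinations of words of length `k` in the creation operators, their adjoints, and
the vertex projections. -/
def homogeneous (k : ℕ) : Submodule ℂ (Fock G →L[ℂ] Fock G) :=
  Submodule.span ℂ (wordOp '' {l | l.length = k})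

theorem wordOp_mem_homogeneous (l : List (OEdge G ⊕ OEdge G ⊕ V(G))) :
    wordOp l ∈ homogeneous G l.length :=
  Submodule.subset_span ⟨l, rfl, rfl⟩

theorem fockOp_mem_homogeneous (g : OEdge G ⊕ OEdge G ⊕ V(G)) :
    fockOp g ∈ homogeneous G 1 := by
  have := wordOp_mem_homogeneous [g]
  simpa [wordOp] using this

theorem mul_mem_homogeneous {S T : Fock G →L[ℂ] Fock G} {j k : ℕ} (hS : S ∈ homogeneous G j)
    (hT : T ∈ homogeneous G k) : S * T ∈ homogeneous G (j + k) := by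
  have h := Submodule.mul_mem_mul hS hT
  rw [homogeneous, homogeneous, Submodule.span_mul_span] at h
  refine Submodule.span_mono ?_ h
  rintro _ ⟨_, ⟨l, hl, rfl⟩, _, ⟨m, hm, rfl⟩, rfl⟩
  refine ⟨l ++ m, ?_, wordOp_append l m⟩
  rw [mem_ofPred_eq] at hl hm ⊢
  simp [hl, hm]

variable [Fintype V(G)]

theorem sum_vproj : ∑ x : V(G), vproj x = (1 : Fock G →L[ℂ] Fock G) := by
  classical
  ext1 f
  apply ext_pathCoeff
  intro x l
  simp [sum_apply, map_sum, pathCoeff_vproj]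

/-- Since the unit is the sum of the vertex projections, words can be padded by letters. Hence every
polynomial is homogeneous of each sufficiently large degree, and a single power u^k serves all
entries of a matrix. -/
theorem one_mem_homogeneous : (1 : Fock G →L[ℂ] Fock G) ∈ homogeneous G 1 := by
  rw [← sum_vproj]
  exact Submodule.sum_mem _ fun x _ => fockOp_mem_homogeneous (.inr (.inr x))

theorem homogeneous_mono : Monotone (homogeneous G) := by
  refine monotone_nat_of_le_succ fun k T hT => ?_
  simpa using mul_mem_homogeneous hT one_mem_homogeneous

theorem exists_mem_homogeneous {μ : V(G) → ℝ≥0} {T : Fock G →L[ℂ] Fock G}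
    (hT : T ∈ polyAlg μ) : ∃ k, T ∈ homogeneous G k := by
  induction hT using Algebra.adjoin_induction with
  | mem T hT =>
    refine ⟨1, ?_⟩
    rcases hT with ⟨ε, rfl⟩ | ⟨x, rfl⟩
    · exact add_mem (Submodule.smul_mem _ _ (fockOp_mem_homogeneous (.inl ε)))
        (Submodule.smul_mem _ _ (fockOp_mem_homogeneous (.inr (.inl ε.op))))
    · exact fockOp_mem_homogeneous (.inr (.inr x))
  | algebraMap c =>
    refine ⟨1, ?_⟩
    rw [Algebra.algebraMap_eq_smul_one]
    exact Submodule.smul_mem _ _ one_mem_homogeneous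
  | add S T _ _ hS hT =>
    obtain ⟨j, hS⟩ := hS
    obtain ⟨k, hT⟩ := hT
    exact ⟨max j k, add_mem (homogeneous_mono (le_max_left j k) hS)
      (homogeneous_mono (le_max_right j k) hT)⟩
  | mul S T _ _ hS hT =>
    obtain ⟨j, hS⟩ := hS
    obtain ⟨k, hT⟩ := hT
    exact ⟨j + k, mul_mem_homogeneous hS hT⟩

theorem exists_forall_mem_homogeneous {μ : V(G) → ℝ≥0} {κ : Type*} [Finite κ]
    {P : κ → Fock G →L[ℂ] Fock G} (hP : ∀ i, P i ∈ polyAlg μ) :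
    ∃ k, 1 ≤ k ∧ ∀ i, P i ∈ homogeneous G k := by
  cases nonempty_fintype κ
  choose k hk using fun i => exists_mem_homogeneous (hP i)
  exact ⟨Finset.univ.sup k + 1, by omega, fun i =>
    homogeneous_mono ((Finset.le_sup (Finset.mem_univ i)).trans (Nat.le_succ _)) (hk i)⟩

variable [Fintype (OEdge G)]

variable (G) in
/-- The words of length less than `k`. -/
abbrev ShortWord (k : ℕ) : Type _ := {l : List (OEdge G ⊕ OEdge G ⊕ V(G)) // l.length < k}

instance (k : ℕ) : Fintype (ShortWord G k) :=
  have : Finite (ShortWord G k) :=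
    (List.finite_length_lt (OEdge G ⊕ OEdge G ⊕ V(G)) k).to_subtype
  Fintype.ofFinite _

/-- The first letter is split off, so only words of length exactly k - 1 remain. The sum runs over
all shorter words too, with coefficient zero, because these index the rows of the linearization. -/
theorem exists_coeff_of_mem_homogeneous {k : ℕ} (hk : 1 ≤ k) {T : Fock G →L[ℂ] Fock G}
    (hT : T ∈ homogeneous G k) : ∃ c : (OEdge G ⊕ OEdge G ⊕ V(G)) → ShortWord G k → ℂ,
      T = ∑ w : ShortWord G k, ∑ g, (if w.1.length + 1 = k then c g w else 0) •
        (fockOp g * wordOp w.1) := by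
  classical
  induction hT using Submodule.span_induction with
  | mem T hT =>
    obtain ⟨l, hl, rfl⟩ := hT
    rw [mem_ofPred_eq] at hl
    cases l with
    | nil => simp at hl; omega
    | cons g l =>
      have hl' : l.length < k := by simp at hl; omega
      refine ⟨fun h w => if h = g ∧ w = ⟨l, hl'⟩ then 1 else 0, ?_⟩
      rw [Finset.sum_eq_single ⟨l, hl'⟩, Finset.sum_eq_single g]
      · simpa [wordOp_cons] using fun h => absurd hl h
      · intro h _ hh
        simp [hh]
      · simp
      · intro w _ hw
        simp [hw]
      · simp
  | zero => exact ⟨0, by simp⟩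
  | add S T _ _ hS hT =>
    obtain ⟨c, rfl⟩ := hS
    obtain ⟨d, rfl⟩ := hT
    refine ⟨c + d, ?_⟩
    rw [← Finset.sum_add_distrib]
    refine Finset.sum_congr rfl fun w _ => ?_
    rw [← Finset.sum_add_distrib]
    refine Finset.sum_congr rfl fun g _ => ?_
    split_ifs <;> simp [add_smul]
  | smul a T _ hT =>
    obtain ⟨c, rfl⟩ := hT
    refine ⟨a • c, ?_⟩
    rw [Finset.smul_sum]
    refine Finset.sum_congr rfl fun w _ => ?_
    rw [Finset.smul_sum]
    refine Finset.sum_congr rfl fun g _ => ?_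
    split_ifs <;> simp [smul_smul]

variable {κ : Type*} [Fintype κ] [DecidableEq κ]

open Classical in
/-- The coefficients of the linearization of the matrix with entries
`∑ w g, c i j g w • g * w`, the sum over the words `w` of length `k - 1`. -/
def linearization {k : ℕ} (c : κ → κ → (OEdge G ⊕ OEdge G ⊕ V(G)) → ShortWord G k → ℂ)
    (i j : κ × ShortWord G k) (g : OEdge G ⊕ OEdge G ⊕ V(G)) : ℂ :=
  if i.2.1 = [] then (if j.2.1.length + 1 = k then c i.1 j.1 g j.2 else 0)
  else if i.1 = j.1 ∧ i.2.1 = g :: j.2.1 then 1 else 0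

/-- The new unknowns are u^|w| w ψ for words w of length less than k. The row of a word g :: l
builds its unknown from that of l by one letter and one factor u. The row of the empty word is the
original equation, with u^k split as u times u^(k-1). -/
theorem pencil_linearization {k : ℕ}
    (c : κ → κ → (OEdge G ⊕ OEdge G ⊕ V(G)) → ShortWord G k → ℂ)
    {P : κ → κ → Fock G →L[ℂ] Fock G}
    (hc : ∀ i j, P i j = ∑ w : ShortWord G k, ∑ g,
      (if w.1.length + 1 = k then c i j g w else 0) • (fockOp g * wordOp w.1))
    {u : ℂ} {ψ e : κ → Fock G} (hψ : ∀ i, ψ i = e i + u ^ k • ∑ j, P i j (ψ j)) :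
    (fun i : κ × ShortWord G k => u ^ i.2.1.length • wordOp i.2.1 (ψ i.1)) =
      (fun i : κ × ShortWord G k => if i.2.1 = [] then e i.1 else 0) +
      u • pencil (linearization c) (fun i => u ^ i.2.1.length • wordOp i.2.1 (ψ i.1)) := by
  classical
  funext ⟨i, w, hw⟩
  rw [Pi.add_apply, Pi.smul_apply, pencil_apply, Fintype.sum_prod_type]
  cases w with
  | nil =>
    simp only [List.length_nil, pow_zero, one_smul, if_true, wordOp, List.map_nil, List.prod_nil,
      one_apply_eq_self]
    rw [hψ i]
    congr 1
    rw [Finset.smul_sum, Finset.smul_sum]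
    refine Finset.sum_congr rfl fun j _ => ?_
    rw [hc, sum_apply, Finset.smul_sum, Finset.smul_sum]
    refine Finset.sum_congr rfl fun w _ => ?_
    rw [sum_apply, fockSum, sum_apply, Finset.smul_sum, Finset.smul_sum]
    refine Finset.sum_congr rfl fun g _ => ?_
    simp only [linearization, if_true]
    split_ifs with h
    · rw [smul_apply, smul_apply, mul_apply_eq_comp, map_smul, smul_comm _ (u ^ w.1.length),
        smul_smul u, ← pow_succ', h]
      rfl
    · simp
  | cons g l =>
    have hl : l.length < k := by simp at hw; omega
    have h0 : ∀ j, (∑ w : ShortWord G k, fockSum (linearization c (i, ⟨g :: l, hw⟩) (j, w))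
        (u ^ w.1.length • wordOp w.1 (ψ j))) =
        if i = j then u ^ l.length • fockOp g (wordOp l (ψ j)) else 0 := by
      intro j
      rw [Finset.sum_eq_single ⟨l, hl⟩, fockSum, sum_apply, Finset.sum_eq_single g]
      · by_cases h : i = j <;> simp [linearization, h]
      · intro h _ hh
        simp [linearization, hh.symm]
      · simp
      · intro w _ hw
        rw [fockSum, sum_apply]
        refine Finset.sum_eq_zero fun h _ => ?_
        have : l ≠ w.1 := fun h => hw (Subtype.ext h.symm)
        simp [linearization, this]
      · simp
    simp only [h0, Finset.sum_ite_eq, Finset.mem_univ, if_true, wordOp_cons, mul_apply_eq_comp]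
    simp [smul_smul, pow_succ']

open Polynomial in
/-- The vacuum expectations of the resolvent of a matrix of polynomials of degree at most `k` are
algebraic functions, after the substitution `u ↦ u ^ k`. -/
theorem exists_polynomial_of_homogeneous {k : ℕ} (hk : 1 ≤ k) {P : κ → κ → Fock G →L[ℂ] Fock G}
    (hP : ∀ i j, P i j ∈ homogeneous G k) (w : V(G) → κ → κ → ℂ) :
    ∃ δ > 0, ∃ Q : ℂ[X][X], Q ≠ 0 ∧ ∀ u ∈ Metric.ball (0 : ℂ) δ, ∀ ψ : V(G) → κ → κ → Fock G,
      (∀ x i j, ψ x i j = (if i = j then vac x else 0) + u ^ k • ∑ m, P i m (ψ x m j)) →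
      Q.eval₂ (evalRingHom u) (∑ x, ∑ i, ∑ j, w x i j * pathCoeff x [] (ψ x i j)) = 0 := by
  classical
  choose c hc using fun i j => exists_coeff_of_mem_homogeneous hk (hP i j)
  have h0 : ([] : List (OEdge G ⊕ OEdge G ⊕ V(G))).length < k := by simp; omega
  -- The original unknowns sit at the empty word, so the weights keep only the entries in which both
  -- words are empty.
  obtain ⟨Q, hQ, hQ0⟩ := exists_polynomial_vacuumResolvent (linearization c)
    (fun j => if j.2.1.2 = ⟨[], h0⟩ ∧ j.2.2.2 = ⟨[], h0⟩ then w j.1 j.2.1.1 j.2.2.1 else 0)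
  refine ⟨(‖pencil (linearization c)‖ + 1)⁻¹, by positivity, Q, hQ, fun u hu ψ hψ => ?_⟩
  rw [← hQ0 u hu]
  congr 1
  have h1 : ∀ x i j, pathCoeff x [] (ψ x i j) =
      vacuumResolvent (linearization c) (x, (i, ⟨[], h0⟩), (j, ⟨[], h0⟩)) u := by
    intro x i j
    have h2 := eq_pencilInv (isUnit_one_sub_pencil _ hu)
      (pencil_linearization c hc (u := u) (ψ := fun i => ψ x i j) (fun i => hψ x i j))
    have h3 : (fun i : κ × ShortWord G k => if i.2.1 = [] then (if i.1 = j then vac x else 0)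
        else 0) = Pi.single (j, ⟨[], h0⟩) (vac x) := by
      funext ⟨i, l, hl⟩
      rw [Pi.single_apply]
      by_cases h : l = []
      · subst h
        simp
      · simp [h]
    rw [h3] at h2
    have h4 := congrArg (pathCoeff x []) (congrFun h2 (i, ⟨[], h0⟩))
    rw [vacuumResolvent, ← h4]
    simp [wordOp]
  simp only [h1, Fintype.sum_prod_type]
  refine Finset.sum_congr rfl fun x _ => Finset.sum_congr rfl fun i _ => ?_
  rw [Finset.sum_eq_single (⟨[], h0⟩ : ShortWord G k)]
  · refine Finset.sum_congr rfl fun j _ => ?_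
    rw [Finset.sum_eq_single (⟨[], h0⟩ : ShortWord G k)]
    · simp
    · intro l _ hl
      simp [hl]
    · simp
  · intro l _ hl
    simp [hl]
  · simp

end FreeGraph

/-! ### Decay of algebraic functions -/

open Polynomial in
-- After division by u^D, the value differs from the coefficient of degree D by O(1/u).
theorem Polynomial.exists_norm_eval_sub_le {q : ℂ[X]} {D : ℕ} (hq : q.natDegree ≤ D) :
    ∃ C : ℝ, ∀ u : ℝ, 1 ≤ u → ‖q.eval (u : ℂ) - q.coeff D * (u : ℂ) ^ D‖ * u ≤ C * u ^ D := by
  refine ⟨∑ i ∈ Finset.range D, ‖q.coeff i‖, fun u hu => ?_⟩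
  have h0 : 0 ≤ u := by linarith
  rw [eval_eq_sum_range' (Nat.lt_succ_of_le hq), Finset.sum_range_succ, add_sub_cancel_right]
  calc ‖∑ i ∈ Finset.range D, q.coeff i * (u : ℂ) ^ i‖ * u
      ≤ (∑ i ∈ Finset.range D, ‖q.coeff i * (u : ℂ) ^ i‖) * u := by
        gcongr
        exact norm_sum_le _ _
    _ ≤ _ := by
        rw [Finset.sum_mul, Finset.sum_mul]
        refine Finset.sum_le_sum fun i hi => ?_
        rw [norm_mul, norm_pow, Complex.norm_real, Real.norm_of_nonneg h0, mul_assoc, ← pow_succ]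
        gcongr 1
        exact pow_le_pow_right₀ hu (Nat.succ_le_of_lt (Finset.mem_range.1 hi))

open Polynomial in
-- Near zero, p behaves like a nonzero constant times the power of X given by the multiplicity of
-- its root at 0, so smallness of p(h) forces smallness of a power of h.
theorem Polynomial.eventually_norm_pow_le {p : ℂ[X]} (hp : p ≠ 0) {h : ℝ → ℂ}
    (hh : Tendsto h atTop (𝓝 0)) {C : ℝ} (hC : ∀ᶠ u : ℝ in atTop, ‖p.eval (h u)‖ * u ≤ C) :
    ∃ m : ℕ, 1 ≤ m ∧ ∃ C' : ℝ, ∀ᶠ u : ℝ in atTop, ‖h u‖ ^ m * u ≤ C' := by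
  obtain ⟨q, hq, hq0⟩ := exists_eq_pow_rootMultiplicity_mul_and_not_dvd p hp 0
  rw [dvd_iff_isRoot, IsRoot.def] at hq0
  set m := p.rootMultiplicity 0
  -- The multiplicity may be zero, while a positive exponent is wanted; raising it by one is
  -- harmless because ‖h u‖ < 1 eventually.
  refine ⟨m + 1, by omega, 2 * C / ‖q.eval 0‖, ?_⟩
  have h0 : 0 < ‖q.eval 0‖ := norm_pos_iff.2 hq0
  have h1 : Tendsto (fun u => ‖q.eval (h u)‖) atTop (𝓝 ‖q.eval 0‖) :=
    ((q.continuous.tendsto 0).comp hh).norm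
  have h2 := h1.eventually_const_lt (show ‖q.eval 0‖ / 2 < ‖q.eval 0‖ by linarith)
  have h3 := hh.norm.eventually_lt_const (show ‖(0 : ℂ)‖ < 1 by simp)
  filter_upwards [hC, h2, h3, eventually_ge_atTop 0] with u hu1 hu2 hu3 hu4
  rw [le_div_iff₀ h0]
  rw [hq] at hu1
  simp only [map_zero, sub_zero, eval_mul, eval_pow, eval_X, norm_mul, norm_pow] at hu1
  have h5 : ‖h u‖ ^ (m + 1) ≤ ‖h u‖ ^ m :=
    pow_le_pow_of_le_one (norm_nonneg _) hu3.le (Nat.le_succ _)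
  calc ‖h u‖ ^ (m + 1) * u * ‖q.eval 0‖ ≤ ‖h u‖ ^ m * u * (2 * ‖q.eval (h u)‖) := by
        gcongr
        linarith
    _ = 2 * (‖h u‖ ^ m * ‖q.eval (h u)‖ * u) := by ring
    _ ≤ 2 * C := by gcongr

open Polynomial in
/-- An algebraic function that tends to a limit at infinity does so at a polynomial rate. -/
theorem Polynomial.exists_norm_pow_le_of_eval₂_eq_zero {Q : ℂ[X][X]} (hQ : Q ≠ 0) (c : ℂ)
    {h : ℝ → ℂ} (hh : Tendsto h atTop (𝓝 0))
    (hroot : ∀ᶠ u : ℝ in atTop, Q.eval₂ (evalRingHom (u : ℂ)) (c + h u) = 0) :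
    ∃ m : ℕ, 1 ≤ m ∧ ∃ C : ℝ, ∀ᶠ u : ℝ in atTop, ‖h u‖ ^ m * u ≤ C := by
  -- Translating the root by c makes h itself a root.
  let Q' := taylor (C c) Q
  have hQ' : Q' ≠ 0 := fun h => hQ (taylor_injective (C c) (by rw [map_zero]; exact h))
  have hroot' : ∀ᶠ u : ℝ in atTop, Q'.eval₂ (evalRingHom (u : ℂ)) (h u) = 0 := by
    filter_upwards [hroot] with u hu
    change eval₂ _ _ (taylor (C c) Q) = 0
    rw [← hu, taylor_apply, eval₂_comp]
    congr 1
    simp [add_comm]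
  let D := Q'.support.sup fun j => (Q'.coeff j).natDegree
  have hdeg : ∀ j, (Q'.coeff j).natDegree ≤ D := by
    intro j
    by_cases hj : j ∈ Q'.support
    · exact Finset.le_sup (f := fun j => (Q'.coeff j).natDegree) hj
    · rw [notMem_support_iff.1 hj]
      simp
  choose K hK using fun j => exists_norm_eval_sub_le (hdeg j)
  -- This is the limit of u^(-D) Q'(u, ·) as u tends to infinity. It is nonzero because some
  -- coefficient of Q' attains the maximal degree D. Since h is a root of Q', p(h) is O(1/u).
  let p : ℂ[X] := ∑ j ∈ Finset.range (Q'.natDegree + 1), C ((Q'.coeff j).coeff D) * X ^ j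
  have hp : p ≠ 0 := by
    obtain ⟨j, hj, hjD⟩ := Finset.exists_mem_eq_sup Q'.support (support_nonempty.2 hQ')
      fun j => (Q'.coeff j).natDegree
    intro h
    have h1 := congrArg (fun r : ℂ[X] => r.coeff j) h
    have h2 : j ∈ Finset.range (Q'.natDegree + 1) :=
      Finset.mem_range.2 (Nat.lt_succ_of_le (le_natDegree_of_mem_supp j hj))
    simp only [p, finsetSum_coeff, coeff_C_mul, coeff_X_pow, mul_ite, mul_one, mul_zero,
      Finset.sum_ite_eq, h2, if_true, coeff_zero] at h1
    have h3 : D = (Q'.coeff j).natDegree := hjD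
    rw [h3, coeff_natDegree, leadingCoeff_eq_zero] at h1
    exact mem_support_iff.1 hj h1
  refine eventually_norm_pow_le hp hh (C := ∑ j ∈ Finset.range (Q'.natDegree + 1), K j) ?_
  have h3 := hh.norm.eventually_lt_const (show ‖(0 : ℂ)‖ < 1 by simp)
  filter_upwards [hroot', h3, eventually_ge_atTop 1] with u hu1 hu2 hu3
  have hu0 : 0 < u := by linarith
  rw [eval₂_eq_sum_range] at hu1
  simp only [coe_evalRingHom] at hu1
  have h4 : p.eval (h u) * (u : ℂ) ^ D = -∑ j ∈ Finset.range (Q'.natDegree + 1),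
      ((Q'.coeff j).eval (u : ℂ) - (Q'.coeff j).coeff D * (u : ℂ) ^ D) * h u ^ j := by
    simp only [sub_mul, Finset.sum_sub_distrib, hu1, p, eval_finsetSum, eval_mul, eval_C,
      eval_pow, eval_X, Finset.sum_mul]
    rw [zero_sub, neg_neg]
    exact Finset.sum_congr rfl fun j _ => by ring
  have h5 : ‖p.eval (h u)‖ * u * u ^ D ≤
      (∑ j ∈ Finset.range (Q'.natDegree + 1), K j) * u ^ D := by
    have h6 : ‖p.eval (h u)‖ * u ^ D = ‖p.eval (h u) * (u : ℂ) ^ D‖ := by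
      rw [norm_mul, norm_pow, Complex.norm_real, Real.norm_of_nonneg hu0.le]
    rw [mul_right_comm, h6, h4, norm_neg, Finset.sum_mul]
    refine (mul_le_mul_of_nonneg_right (norm_sum_le _ _) hu0.le).trans ?_
    rw [Finset.sum_mul]
    refine Finset.sum_le_sum fun j _ => ?_
    refine le_trans ?_ (hK j u hu3)
    rw [norm_mul, norm_pow]
    gcongr
    exact mul_le_of_le_one_right (norm_nonneg _) (pow_le_one₀ (norm_nonneg _) hu2.le)
  exact le_of_mul_le_mul_right h5 (by positivity)

/-! ### Measures with an algebraic resolvent transform -/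

section Measure

variable {ν : Measure ℝ} [IsFiniteMeasure ν]

theorem ae_nonneg_of_Iio {ν : Measure ℝ} (hν : ν (Iio 0) = 0) : ∀ᵐ t ∂ν, 0 ≤ t := by
  rw [ae_iff]
  simp only [not_le]
  exact hν

theorem integrable_inv_one_add_mul (hν : ν (Iio 0) = 0) {s : ℝ} (hs : 0 ≤ s) :
    Integrable (fun t => (1 + s * t)⁻¹) ν := by
  have h0 := ae_nonneg_of_Iio hν
  refine Integrable.mono' (integrable_const 1) (by fun_prop) ?_
  filter_upwards [h0] with t ht
  have : 0 ≤ s * t := by positivity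
  rw [Real.norm_of_nonneg (by positivity)]
  exact inv_le_one_of_one_le₀ (by linarith)

theorem tendsto_integral_inv_one_add_mul (hν : ν (Iio 0) = 0) :
    Tendsto (fun s : ℝ => ∫ t, (1 + s * t)⁻¹ ∂ν) atTop (𝓝 (ν.real {0})) := by
  have h0 := ae_nonneg_of_Iio hν
  have h1 : ν.real {0} = ∫ t, ({0} : Set ℝ).indicator 1 t ∂ν := by
    rw [integral_indicator_one (measurableSet_singleton 0)]
  rw [h1]
  refine tendsto_integral_filter_of_dominated_convergence (fun _ => 1) ?_ ?_
    (integrable_const 1) ?_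
  · exact Eventually.of_forall fun s => by fun_prop
  · filter_upwards [eventually_ge_atTop 0] with s hs
    filter_upwards [h0] with t ht
    have : 0 ≤ s * t := by positivity
    rw [Real.norm_of_nonneg (by positivity)]
    exact inv_le_one_of_one_le₀ (by linarith)
  · filter_upwards [h0] with t ht
    rcases ht.eq_or_lt with rfl | ht
    · simp
    · have : t ∉ ({0} : Set ℝ) := ht.ne'
      rw [indicator_of_notMem this]
      refine tendsto_inv_atTop_zero.comp ?_
      exact tendsto_atTop_add_const_left _ _ (tendsto_id.atTop_mul_const ht)

/-- The integrand equals 1 at t = 0 and is at least 1/2 on (0, 1/s]; the atom at zero is subtracted.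
-/
theorem measureReal_Ioc_le_integral (hν : ν (Iio 0) = 0) {s : ℝ} (hs : 0 < s) :
    ν.real (Ioc 0 s⁻¹) ≤ 2 * (∫ t, (1 + s * t)⁻¹ ∂ν - ν.real {0}) := by
  have h1 : ∫ t, ({0} : Set ℝ).indicator (1 : ℝ → ℝ) t + 2⁻¹ * (Ioc 0 s⁻¹).indicator 1 t ∂ν =
      ν.real {0} + 2⁻¹ * ν.real (Ioc 0 s⁻¹) := by
    rw [integral_add, integral_const_mul, integral_indicator_one (measurableSet_singleton 0),
      integral_indicator_one measurableSet_Ioc]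
    · exact (integrable_const 1).indicator (measurableSet_singleton 0)
    · exact ((integrable_const 1).indicator measurableSet_Ioc).const_mul _
  have h0 := ae_nonneg_of_Iio hν
  have h2 : ν.real {0} + 2⁻¹ * ν.real (Ioc 0 s⁻¹) ≤ ∫ t, (1 + s * t)⁻¹ ∂ν := by
    rw [← h1]
    refine integral_mono_ae ?_ (integrable_inv_one_add_mul hν hs.le) ?_
    · exact ((integrable_const 1).indicator (measurableSet_singleton 0)).add
        (((integrable_const 1).indicator measurableSet_Ioc).const_mul _)
    · filter_upwards [h0] with t ht
      have hst : 0 ≤ s * t := by positivity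
      rcases ht.eq_or_lt with rfl | ht
      · simp
      · have : t ∉ ({0} : Set ℝ) := ht.ne'
        rw [indicator_of_notMem this, zero_add]
        by_cases h : t ∈ Ioc 0 s⁻¹
        · rw [indicator_of_mem h, Pi.one_apply, mul_one]
          have h3 : s * t ≤ 1 := by
            calc s * t ≤ s * s⁻¹ := by gcongr; exact h.2
              _ = 1 := mul_inv_cancel₀ hs.ne'
          gcongr
          linarith
        · rw [indicator_of_notMem h, mul_zero]
          positivity
  linarith

open Polynomial in
/-- If the resolvent transform of a finite measure on `[0, ∞)` is algebraic, then the distribution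
function grows like a power at zero. -/
theorem exists_measureReal_Ioc_le (hν : ν (Iio 0) = 0) {k : ℕ} (hk : 1 ≤ k) {Q : ℂ[X][X]}
    (hQ : Q ≠ 0) (hroot : ∀ u : ℝ, 0 ≤ u →
      Q.eval₂ (evalRingHom (u : ℂ)) ((∫ t, (1 + u ^ k * t)⁻¹ ∂ν : ℝ) : ℂ) = 0) :
    ∃ C a : ℝ, 0 < a ∧ ∀ t, 0 < t → ν.real (Ioc 0 t) ≤ C * t ^ a := by
  let h : ℝ → ℂ := fun u => ((∫ t, (1 + u ^ k * t)⁻¹ ∂ν - ν.real {0} : ℝ) : ℂ)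
  have hh : Tendsto h atTop (𝓝 0) := by
    have h1 := (tendsto_integral_inv_one_add_mul hν).comp (tendsto_pow_atTop (α := ℝ)
      (n := k) (by omega))
    have h2 := (h1.sub_const (ν.real {0})).ofReal
    rw [sub_self] at h2
    exact h2
  obtain ⟨m, hm, K, hK⟩ := exists_norm_pow_le_of_eval₂_eq_zero hQ (ν.real {0}) hh (by
    filter_upwards [eventually_ge_atTop 0] with u hu
    rw [← hroot u hu]
    congr 1
    simp [h])
  obtain ⟨u₀, hu₀⟩ := eventually_atTop.1 hK
  set u₁ := max u₀ 1
  have hu₁ : 0 < u₁ := by positivity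
  have hk0 : (k : ℝ) ≠ 0 := by positivity
  have hm0 : (m : ℝ) ≠ 0 := by positivity
  -- The choice u = t^(-1/k) makes u^k = 1/t, so that the decay of h at u bounds the mass of (0, t].
  -- The bound on t ensures u ≥ u₁, where the decay estimate is valid.
  have hpow : ∀ {t : ℝ}, 0 < t → t ≤ (u₁ ^ k)⁻¹ →
      ν.real (Ioc 0 t) ^ m ≤ 2 ^ m * K * t ^ (1 / k : ℝ) := by
    intro t ht0 ht
    let u := t⁻¹ ^ (1 / k : ℝ)
    have hu0 : 0 < u := by positivity
    have huk : u ^ k = t⁻¹ := by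
      rw [← Real.rpow_natCast, ← Real.rpow_mul (by positivity), one_div_mul_cancel hk0,
        Real.rpow_one]
    have huu : u₁ ≤ u := by
      refine le_of_pow_le_pow_left₀ (n := k) (by omega) hu0.le ?_
      rw [huk]
      rwa [le_inv_comm₀ (by positivity) ht0]
    have h1 := hu₀ u ((le_max_left _ _).trans huu)
    have h2 := measureReal_Ioc_le_integral hν (s := u ^ k) (by positivity)
    rw [huk, inv_inv] at h2
    have h3 : ‖h u‖ = |∫ t, (1 + u ^ k * t)⁻¹ ∂ν - ν.real {0}| := by
      rw [Complex.norm_real, Real.norm_eq_abs]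
    have h4 : ν.real (Ioc 0 t) ≤ 2 * ‖h u‖ := by
      rw [h3, huk]
      exact h2.trans (by gcongr; exact le_abs_self _)
    have h5 : t ^ (1 / k : ℝ) = u⁻¹ := by
      rw [← Real.inv_rpow (by positivity), inv_inv]
    calc ν.real (Ioc 0 t) ^ m ≤ (2 * ‖h u‖) ^ m := by gcongr
      _ = 2 ^ m * ‖h u‖ ^ m := by ring
      _ ≤ 2 ^ m * (K * u⁻¹) := by
        gcongr
        rwa [← div_eq_mul_inv, le_div_iff₀ hu0]
      _ = _ := by rw [h5]; ring
  have hK0 : 0 ≤ K := by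
    refine le_trans ?_ (hu₀ u₁ (le_max_left _ _))
    positivity
  set a : ℝ := 1 / k * (1 / m) with ha
  have ha0 : 0 < a := by positivity
  set C₁ : ℝ := (2 ^ m * K) ^ (1 / m : ℝ)
  -- `C₂` covers t ≥ u₁^(-k), where the total mass suffices because (u₁^k t)^a ≥ 1.
  set C₂ : ℝ := ν.real univ * (u₁ ^ k) ^ a
  refine ⟨C₁ + C₂, a, ha0, fun t ht => ?_⟩
  have hC₁ : 0 ≤ C₁ := by positivity
  have hC₂ : 0 ≤ C₂ := by positivity
  rcases le_total t (u₁ ^ k)⁻¹ with h1 | h1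
  · have h2 : ν.real (Ioc 0 t) ≤ C₁ * t ^ a := by
      calc ν.real (Ioc 0 t) = (ν.real (Ioc 0 t) ^ m) ^ (1 / m : ℝ) := by
            rw [← Real.rpow_natCast, ← Real.rpow_mul (by positivity), mul_one_div_cancel hm0,
              Real.rpow_one]
        _ ≤ (2 ^ m * K * t ^ (1 / k : ℝ)) ^ (1 / m : ℝ) := by
            gcongr
            exact hpow ht h1
        _ = _ := by
            rw [Real.mul_rpow (by positivity) (by positivity), ← Real.rpow_mul ht.le]
    nlinarith [Real.rpow_nonneg ht.le a]
  · have h2 : ν.real (Ioc 0 t) ≤ C₂ * t ^ a := by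
      calc ν.real (Ioc 0 t) ≤ ν.real univ := measureReal_mono (subset_univ _)
        _ = ν.real univ * 1 := by rw [mul_one]
        _ ≤ ν.real univ * (u₁ ^ k * t) ^ a := by
            gcongr
            refine Real.one_le_rpow ?_ ha0.le
            rwa [inv_le_iff_one_le_mul₀' (by positivity)] at h1
        _ = _ := by
            rw [Real.mul_rpow (by positivity) ht.le, mul_assoc]
    nlinarith [Real.rpow_nonneg ht.le a]

end Measure

/-! ### Integrability of the logarithm -/

section Measure

variable {ν : Measure ℝ} [IsFiniteMeasure ν]

/-- The numerator is ν((0,t]), so the quotient is dominated by C t^(a-1), which is integrable at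
zero. -/
theorem integrableOn_div_of_measureReal_Ioc_le {C a : ℝ} (ha : 0 < a)
    (hC : ∀ t, 0 < t → ν.real (Ioc 0 t) ≤ C * t ^ a) (M : ℝ) :
    IntegrableOn (fun t => (ν.real (Iic t) - ν.real (Iic 0)) / t) (Ioc 0 M) volume := by
  rcases le_or_gt M 0 with hM | hM
  · simp [Ioc_eq_empty_of_le hM]
  have h1 : IntegrableOn (fun t : ℝ => C * t ^ (a - 1)) (Ioc 0 M) volume := by
    have := (intervalIntegral.intervalIntegrable_rpow' (a := 0) (b := M)
      (show -1 < a - 1 by linarith)).const_mul C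
    exact (intervalIntegrable_iff_integrableOn_Ioc_of_le hM.le).1 this
  have hmono : Monotone fun t => ν.real (Iic t) := fun s t hst =>
    measureReal_mono (Iic_subset_Iic.2 hst)
  refine Integrable.mono' h1 ?_ ?_
  · exact ((hmono.measurable.sub_const _).div measurable_id).aestronglyMeasurable
  · rw [ae_restrict_iff' measurableSet_Ioc]
    refine Eventually.of_forall fun t ht => ?_
    have h2 : ν.real (Iic t) - ν.real (Iic 0) = ν.real (Ioc 0 t) := by
      rw [← Iic_sdiff_Iic, measureReal_sdiff (Iic_subset_Iic.2 ht.1.le) measurableSet_Iic]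
    rw [h2, Real.norm_of_nonneg (div_nonneg measureReal_nonneg ht.1.le), div_le_iff₀ ht.1,
      mul_assoc, Real.rpow_sub_one ht.1.ne', div_mul_cancel₀ _ ht.1.ne']
    exact hC t ht.1

/-- Layer-cake formula for the nonnegative function log(M/t): its superlevel set at s lies in (0, M
e^(-s)], of mass at most C M^a e^(-as), which is integrable in s. -/
theorem integrableOn_log_of_measureReal_Ioc_le {C a : ℝ} (ha : 0 < a)
    (hC : ∀ t, 0 < t → ν.real (Ioc 0 t) ≤ C * t ^ a) (M : ℝ) :
    IntegrableOn Real.log (Ioc 0 M) ν := by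
  rcases le_or_gt M 0 with hM | hM
  · simp [Ioc_eq_empty_of_le hM]
  have hmeas : Measurable fun t : ℝ => Real.log (M / t) := by fun_prop
  have hpos : ∀ᵐ t ∂(ν.restrict (Ioc 0 M)), 0 ≤ Real.log (M / t) := by
    rw [ae_restrict_iff' measurableSet_Ioc]
    refine Eventually.of_forall fun t ht => Real.log_nonneg ?_
    rw [le_div_iff₀ ht.1, one_mul]
    exact ht.2
  have h1 : IntegrableOn (fun t => Real.log (M / t)) (Ioc 0 M) ν := by
    refine ⟨hmeas.aestronglyMeasurable, ?_⟩
    rw [hasFiniteIntegral_iff_ofReal hpos, lintegral_eq_lintegral_meas_lt _ hpos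
      hmeas.aemeasurable]
    have hint : IntegrableOn (fun s : ℝ => C * M ^ a * Real.exp (-a * s)) (Ioi 0) volume :=
      (exp_neg_integrableOn_Ioi 0 ha).const_mul _
    refine lt_of_le_of_lt ?_ hint.lintegral_lt_top
    refine setLIntegral_mono' measurableSet_Ioi fun s hs => ?_
    rw [Measure.restrict_apply' measurableSet_Ioc]
    have h2 : {t : ℝ | s < Real.log (M / t)} ∩ Ioc 0 M ⊆ Ioc 0 (M * Real.exp (-s)) := by
      rintro t ⟨ht, ht0, -⟩
      refine ⟨ht0, ?_⟩
      have h3 : Real.exp s < M / t := (Real.lt_log_iff_exp_lt (by positivity)).1 ht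
      rw [lt_div_iff₀ ht0] at h3
      rw [Real.exp_neg, ← div_eq_mul_inv, le_div_iff₀ (Real.exp_pos s), mul_comm]
      exact h3.le
    refine (measure_mono h2).trans ?_
    rw [← ofReal_measureReal]
    apply ENNReal.ofReal_le_ofReal
    refine (hC _ (by positivity)).trans (le_of_eq ?_)
    rw [Real.mul_rpow hM.le (Real.exp_pos _).le, ← Real.exp_mul, mul_assoc]
    ring_nf
  have h4 : IntegrableOn (fun t => Real.log M - Real.log (M / t)) (Ioc 0 M) ν :=
    (integrable_const _).sub h1
  refine h4.congr_fun (fun t ht => ?_) measurableSet_Ioc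
  simp only
  rw [Real.log_div hM.ne' ht.1.ne']
  ring

theorem tendsto_integral_Ioc {f : ℝ → ℝ} {ρ : Measure ℝ} {M : ℝ}
    (hf : IntegrableOn f (Ioc 0 M) ρ) :
    Tendsto (fun δ => ∫ t in Ioc δ M, f t ∂ρ) (𝓝[>] 0) (𝓝 (∫ t in Ioc 0 M, f t ∂ρ)) := by
  have h : ∀ δ, 0 < δ → ∫ t in Ioc δ M, f t ∂ρ =
      ∫ t in Ioc 0 M, (Ioi δ).indicator f t ∂ρ := by
    intro δ hδ
    rw [setIntegral_indicator measurableSet_Ioi, Ioc_inter_Ioi, max_eq_right hδ.le]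
  refine Tendsto.congr' (f₁ := fun δ => ∫ t in Ioc 0 M, (Ioi δ).indicator f t ∂ρ) ?_ ?_
  · filter_upwards [self_mem_nhdsWithin] with δ hδ using (h δ hδ).symm
  refine tendsto_integral_filter_of_dominated_convergence (fun t => ‖f t‖) ?_ ?_ hf.norm ?_
  · exact Eventually.of_forall fun δ => hf.aestronglyMeasurable.indicator measurableSet_Ioi
  · exact Eventually.of_forall fun δ => Eventually.of_forall fun t => norm_indicator_le_norm_self _ _
  · rw [ae_restrict_iff' measurableSet_Ioc]
    refine Eventually.of_forall fun t ht => ?_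
    refine tendsto_const_nhds.congr' ?_
    filter_upwards [Ioo_mem_nhdsGT ht.1] with δ hδ
    exact (indicator_of_mem (show t ∈ Ioi δ from hδ.2) f).symm

theorem tendsto_integral_Icc {f : ℝ → ℝ} {ρ : Measure ℝ} {M : ℝ}
    (hf : IntegrableOn f (Ioc 0 M) ρ) :
    Tendsto (fun δ => ∫ t in Icc δ M, f t ∂ρ) (𝓝[>] 0) (𝓝 (∫ t in Ioc 0 M, f t ∂ρ)) := by
  have h : ∀ δ, 0 < δ → ∫ t in Icc δ M, f t ∂ρ =
      ∫ t in Ioc 0 M, (Ici δ).indicator f t ∂ρ := by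
    intro δ hδ
    rw [setIntegral_indicator measurableSet_Ici]
    congr 2
    ext t
    simp only [mem_Icc, mem_inter_iff, mem_Ioc, mem_Ici]
    constructor
    · rintro ⟨h1, h2⟩
      exact ⟨⟨hδ.trans_le h1, h2⟩, h1⟩
    · rintro ⟨⟨-, h2⟩, h1⟩
      exact ⟨h1, h2⟩
  refine Tendsto.congr' (f₁ := fun δ => ∫ t in Ioc 0 M, (Ici δ).indicator f t ∂ρ) ?_ ?_
  · filter_upwards [self_mem_nhdsWithin] with δ hδ using (h δ hδ).symm
  refine tendsto_integral_filter_of_dominated_convergence (fun t => ‖f t‖) ?_ ?_ hf.norm ?_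
  · exact Eventually.of_forall fun δ => hf.aestronglyMeasurable.indicator measurableSet_Ici
  · exact Eventually.of_forall fun δ => Eventually.of_forall fun t => norm_indicator_le_norm_self _ _
  · rw [ae_restrict_iff' measurableSet_Ioc]
    refine Eventually.of_forall fun t ht => ?_
    refine tendsto_const_nhds.congr' ?_
    filter_upwards [Ioo_mem_nhdsGT ht.1] with δ hδ
    exact (indicator_of_mem (show t ∈ Ici δ from hδ.2.le) f).symm

end Measure

/-! ### The resolvent transform of the law -/

section Law

variable {B : Type*} [CStarAlgebra B] [PartialOrder B] [StarOrderedRing B]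

instance (φ : B →ₚ[ℂ] ℂ) (a : B) (ha : IsSelfAdjoint a) : IsFiniteMeasure (law φ a ha) := by
  rw [law]
  infer_instance

theorem law_Iio_zero (φ : B →ₚ[ℂ] ℂ) {a : B} (ha : 0 ≤ a) :
    law φ a (IsSelfAdjoint.of_nonneg ha) (Iio 0) = 0 := by
  rw [law, Measure.map_apply measurable_subtype_coe measurableSet_Iio]
  have h : (Subtype.val ⁻¹' Iio 0 : Set (spectrum ℝ a)) = ∅ := by
    ext ⟨t, ht⟩
    simpa using spectrum_nonneg_of_nonneg ha ht
  rw [h, measure_empty]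

theorem isUnit_one_add_smul {a : B} (ha : 0 ≤ a) {s : ℝ} (hs : 0 ≤ s) :
    IsUnit (1 + s • a) := by
  rcases hs.eq_or_lt with rfl | hs
  · simp
  have h : -s⁻¹ ∉ spectrum ℝ a := fun h => by
    have := spectrum_nonneg_of_nonneg ha h
    have : 0 < s⁻¹ := by positivity
    linarith
  rw [spectrum.notMem_iff] at h
  have h1 : 1 + s • a = (-s) • (algebraMap ℝ B (-s⁻¹) - a) := by
    rw [smul_sub, Algebra.algebraMap_eq_smul_one, smul_smul, neg_mul_neg, mul_inv_cancel₀ hs.ne']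
    simp
  rw [h1]
  exact h.smul (Units.mk0 (-s) (by linarith))

/-- The function (1+st)⁻¹ is continuous on the spectrum, and the functional calculus sends it to the
inverse of 1 + s a. -/
theorem integral_inv_one_add_mul_law (φ : B →ₚ[ℂ] ℂ) {a : B} (ha : 0 ≤ a) {s : ℝ} (hs : 0 ≤ s) :
    ∫ t, (1 + s * t)⁻¹ ∂(law φ a (IsSelfAdjoint.of_nonneg ha)) =
      (φ (Ring.inverse (1 + s • a))).re := by
  have hsa := IsSelfAdjoint.of_nonneg ha
  have hm : MeasurableEmbedding (Subtype.val : spectrum ℝ a → ℝ) :=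
    MeasurableEmbedding.subtype_coe (spectrum.isClosed a).measurableSet
  have h0 : ∀ t : spectrum ℝ a, 1 + s * (t : ℝ) ≠ 0 := by
    intro t
    have : 0 ≤ s * (t : ℝ) := mul_nonneg hs (spectrum_nonneg_of_nonneg ha t.2)
    positivity
  rw [law, hm.integral_map]
  let g : C(spectrum ℝ a, ℝ) := ⟨fun t => (1 + s * (t : ℝ))⁻¹, by
    refine Continuous.inv₀ (by fun_prop) h0⟩
  let f : C_c(spectrum ℝ a, ℝ) := ⟨g, HasCompactSupport.of_compactSpace _⟩
  have h := RealRMK.integral_rieszMeasure (spectralFunctional φ a hsa) f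
  have h2 : spectralFunctional φ a hsa f = (φ (cfcHom hsa g)).re := rfl
  have h3 : cfcHom hsa g * (1 + s • a) = 1 := by
    have h4 : 1 + s • a = cfcHom hsa (1 + s • (ContinuousMap.id ℝ).restrict (spectrum ℝ a)) := by
      rw [map_add, map_one, map_smul, cfcHom_id]
    have h5 : g * (1 + s • (ContinuousMap.id ℝ).restrict (spectrum ℝ a)) = 1 := by
      ext t
      exact inv_mul_cancel₀ (h0 t)
    rw [h4, ← map_mul, h5, map_one]
  have h5 : cfcHom hsa g = Ring.inverse (1 + s • a) := by
    have h6 := isUnit_one_add_smul ha hs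
    calc cfcHom hsa g = cfcHom hsa g * ((1 + s • a) * Ring.inverse (1 + s • a)) := by
          rw [Ring.mul_inverse_cancel _ h6, mul_one]
      _ = _ := by rw [← mul_assoc, h3, one_mul]
  rw [h2, h5] at h
  exact h

end Law

section Law

variable {B : Type*} [CStarAlgebra B] [PartialOrder B] [StarOrderedRing B]

theorem ringInverse_one_add_smul_nonneg {a : B} (ha : 0 ≤ a) {s : ℝ} (hs : 0 ≤ s) :
    0 ≤ Ring.inverse (1 + s • a) := by
  obtain ⟨z, hz⟩ := isUnit_one_add_smul ha hs
  rw [← hz, Ring.inverse_unit]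
  have h : 0 ≤ (z : B) := by
    rw [hz]
    exact add_nonneg zero_le_one (smul_nonneg hs ha)
  exact CFC.inv_nonneg_of_nonneg z h

theorem isUnit_one_add_coe_smul {a : B} (ha : 0 ≤ a) {s : ℝ} (hs : 0 ≤ s) :
    IsUnit (1 + (s : ℂ) • a) := by
  rw [Complex.coe_smul]
  exact isUnit_one_add_smul ha hs

theorem coe_integral_inv_one_add_mul_law (φ : B →ₚ[ℂ] ℂ) {a : B} (ha : 0 ≤ a) {s : ℝ}
    (hs : 0 ≤ s) :
    ((∫ t, (1 + s * t)⁻¹ ∂(law φ a (IsSelfAdjoint.of_nonneg ha)) : ℝ) : ℂ) =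
      φ (Ring.inverse (1 + (s : ℂ) • a)) := by
  rw [integral_inv_one_add_mul_law φ ha hs, Complex.coe_smul]
  have h := map_nonneg φ (ringInverse_one_add_smul_nonneg ha hs)
  exact Complex.ext rfl (Complex.le_def.1 h).2

open Polynomial in
/-- If `u ↦ φ ((1 + u ^ k a)⁻¹)` is algebraic near zero, then the distribution function of the law
of `a` grows like a power at zero. -/
theorem exists_measureReal_law_Ioc_le (φ : B →ₚ[ℂ] ℂ) {a : B} (ha : 0 ≤ a) {k : ℕ} (hk : 1 ≤ k)
    {δ : ℝ} (hδ : 0 < δ) {Q : ℂ[X][X]} (hQ : Q ≠ 0)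
    (hroot : ∀ u ∈ Metric.ball (0 : ℂ) δ, IsUnit (1 + u ^ k • a) →
      Q.eval₂ (evalRingHom u) (φ (Ring.inverse (1 + u ^ k • a))) = 0) :
    ∃ C c : ℝ, 0 < c ∧
      ∀ t, 0 < t → (law φ a (IsSelfAdjoint.of_nonneg ha)).real (Ioc 0 t) ≤ C * t ^ c := by
  refine exists_measureReal_Ioc_le (law_Iio_zero φ ha) hk hQ ?_
  let f : ℂ → ℂ := fun u => Q.eval₂ (evalRingHom u) (φ (Ring.inverse (1 + u ^ k • a)))
  -- The ray is connected, and 1 + u^k a is invertible at each of its points because a is positive.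
  -- The relation known near 0 therefore propagates along it by the identity theorem.
  let U : Set ℂ := (fun u : ℝ => (u : ℂ)) '' Ici 0
  have hU : IsPreconnected U :=
    (convex_Ici 0).isPreconnected.image _ Complex.continuous_ofReal.continuousOn
  have h0U : (0 : ℂ) ∈ U := ⟨0, self_mem_Ici, Complex.ofReal_zero⟩
  let Φ : B →L[ℂ] ℂ := ⟨φ.toLinearMap, map_continuous φ⟩
  have hinv : ∀ u ∈ U, AnalyticAt ℂ (fun u : ℂ => φ (Ring.inverse (1 + u ^ k • a))) u := by
    rintro _ ⟨u, hu, rfl⟩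
    have h1 : AnalyticAt ℂ (fun u : ℂ => 1 + u ^ k • a) u :=
      analyticAt_const.add ((analyticAt_id.pow k).smul analyticAt_const)
    have h2 : AnalyticAt ℂ (Ring.inverse : B → B) (1 + (u : ℂ) ^ k • a) := by
      have h3 := isUnit_one_add_smul ha (s := u ^ k) (pow_nonneg hu k)
      rw [← Complex.coe_smul, Complex.ofReal_pow] at h3
      obtain ⟨z, hz⟩ := h3
      rw [← hz]
      exact analyticAt_inverse z
    exact (Φ.analyticAt _).fun_comp
      (AnalyticAt.fun_comp (f := fun u : ℂ => 1 + u ^ k • a) h2 h1)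
  have hf : AnalyticOnNhd ℂ f U := by
    intro u hu
    simp only [f, eval₂_eq_sum_range, coe_evalRingHom]
    refine Finset.analyticAt_fun_sum _ fun j _ => ?_
    refine AnalyticAt.mul ?_ ((hinv u hu).pow j)
    have := (analyticAt_id (𝕜 := ℂ) (z := u)).aeval_polynomial (Q.coeff j)
    simpa using this
  have hev : f =ᶠ[𝓝 0] 0 := by
    have h1 : ∀ᶠ u in 𝓝 (0 : ℂ), IsUnit (1 + u ^ k • a) := by
      have h2 : ContinuousAt (fun u : ℂ => 1 + u ^ k • a) 0 := by fun_prop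
      refine h2.eventually (Units.isOpen.mem_nhds ?_)
      have h3 : (0 : ℂ) ^ k = 0 := zero_pow (by omega)
      change IsUnit (1 + (0 : ℂ) ^ k • a)
      rw [h3, zero_smul, add_zero]
      exact isUnit_one
    filter_upwards [h1, Metric.ball_mem_nhds 0 hδ] with u hu1 hu2 using hroot u hu2 hu1
  intro u hu
  have h := hf.eqOn_zero_of_preconnected_of_eventuallyEq_zero hU h0U hev ⟨u, hu, rfl⟩
  rw [coe_integral_inv_one_add_mul_law φ ha (pow_nonneg hu k), Complex.ofReal_pow]
  exact h

end Law

/-! ### Power growth at zero for the laws under the matrix trace and the corner trace -/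

namespace FreeGraph

universe u v

variable {V : Type u} {E : Type v} {G : Graph V E}

theorem vproj_vac (x : V(G)) : vproj x (vac x) = vac x := by
  classical
  apply ext_pathCoeff
  intro y l
  rw [pathCoeff_vproj, pathCoeff_vac]
  split_ifs <;> simp_all

theorem vproj_vac_of_ne {x y : V(G)} (h : x ≠ y) : vproj y (vac x) = 0 := by
  classical
  apply ext_pathCoeff
  intro z l
  rw [pathCoeff_vproj, pathCoeff_vac, map_zero]
  split_ifs with h1 h2 <;> simp_all

theorem adjoint_vproj (x : V(G)) : ContinuousLinearMap.adjoint (vproj x) = vproj (G := G) x := by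
  classical
  ext1 f
  apply lp.ext
  funext p
  by_cases h : p.1.1 = x
  · rw [vproj, adjoint_pullback_apply_of_eq (i := p) _ _ _ (by simp [DPath.at, h]),
      pullback_apply, DPath.at, if_pos h]
    rfl
  · rw [vproj, adjoint_pullback_apply_of_ne, pullback_apply, DPath.at, if_neg h]
    · rfl
    · intro q hq
      rw [DPath.at] at hq
      split_ifs at hq with h1
      cases hq
      exact h h1

variable [Fintype V(G)]

theorem trace_apply (μ : V(G) → ℝ≥0) (T : Fock G →L[ℂ] Fock G) :
    trace μ T = ∑ x, (μ x : ℂ) * pathCoeff x [] (T (vac x)) := by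
  simp only [← inner_vac]
  rfl

theorem cornerTrace_apply (μ : V(G) → ℝ≥0) (x : V(G)) (T : Fock G →L[ℂ] Fock G) :
    cornerTrace μ x T = (μ x : ℂ) * pathCoeff x [] (T (vac x)) := by
  classical
  have h : cornerTrace μ x T = trace μ (star (vproj x) * T * vproj x) := rfl
  rw [h, trace_apply, Finset.sum_eq_single x]
  · rw [ContinuousLinearMap.star_eq_adjoint, adjoint_vproj, mul_apply_eq_comp, mul_apply_eq_comp,
      vproj_vac, pathCoeff_vproj, if_pos rfl]
  · intro y _ hy
    rw [mul_apply_eq_comp, vproj_vac_of_ne hy]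
    simp
  · simp

theorem matrixTrace_apply (μ : V(G) → ℝ≥0) (n : ℕ)
    (T : CStarMatrix (Fin n) (Fin n) (Fock G →L[ℂ] Fock G)) :
    matrixTrace μ n T =
      (n : ℂ)⁻¹ * ∑ i, ∑ x, (μ x : ℂ) * pathCoeff x [] (T i i (vac x)) := by
  simp only [← trace_apply]
  rfl

variable [Finite E(G)]

theorem exists_measureReal_law_matrixTrace_le (μ : V(G) → ℝ≥0) {n : ℕ}
    {P : CStarMatrix (Fin n) (Fin n) (Fock G →L[ℂ] Fock G)} (hPA : ∀ i j, P i j ∈ polyAlg μ)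
    (hP : 0 ≤ P) : ∃ C c : ℝ, 0 < c ∧ ∀ t, 0 < t →
      (law (matrixTrace μ n) P (IsSelfAdjoint.of_nonneg hP)).real (Ioc 0 t) ≤ C * t ^ c := by
  classical
  have := Fintype.ofFinite (OEdge G)
  -- The sign turns 1 + u^k P into the form 1 - u^k(-P) treated by the linearization.
  obtain ⟨k, hk, hkP⟩ := exists_forall_mem_homogeneous (P := fun i : Fin n × Fin n => -P i.1 i.2)
    (fun i => neg_mem (hPA i.1 i.2))
  obtain ⟨δ, hδ, Q, hQ, hroot⟩ := exists_polynomial_of_homogeneous hk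
    (P := fun i j => -P i j) (fun i j => hkP (i, j))
    (fun x i j => if i = j then (n : ℂ)⁻¹ * μ x else 0)
  refine exists_measureReal_law_Ioc_le _ hP hk hδ hQ fun u hu hunit => ?_
  set R := Ring.inverse (1 + u ^ k • P) with hR
  have hRP : R = 1 + u ^ k • (-P * R) := by
    have h := Ring.mul_inverse_cancel _ hunit
    rw [add_mul, one_mul, smul_mul_assoc] at h
    rw [neg_mul, smul_neg, ← sub_eq_add_neg, eq_sub_iff_add_eq]
    exact h
  rw [← hroot u hu (fun x i j => R i j (vac x)) ?_]
  · congr 1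
    rw [matrixTrace_apply, Finset.mul_sum, Finset.sum_comm]
    refine Finset.sum_congr rfl fun i _ => ?_
    rw [Finset.mul_sum]
    refine Finset.sum_congr rfl fun x _ => ?_
    simp [mul_assoc]
  · intro x i j
    conv_lhs => rw [hRP]
    rw [CStarMatrix.add_apply, CStarMatrix.smul_apply, CStarMatrix.mul_apply, add_apply,
      smul_apply, sum_apply]
    congr 1
    rw [CStarMatrix.one_apply]
    split_ifs <;> rfl

theorem exists_measureReal_law_cornerTrace_le (μ : V(G) → ℝ≥0) (x : V(G))
    {P : Fock G →L[ℂ] Fock G} (hPA : P ∈ polyAlg μ)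
    (hP : 0 ≤ P) : ∃ C c : ℝ, 0 < c ∧ ∀ t, 0 < t →
      (law (cornerTrace μ x) P (IsSelfAdjoint.of_nonneg hP)).real (Ioc 0 t) ≤ C * t ^ c := by
  classical
  have := Fintype.ofFinite (OEdge G)
  obtain ⟨k, hk, hkP⟩ := exists_forall_mem_homogeneous (P := fun _ : Unit => -P)
    (fun _ => neg_mem hPA)
  obtain ⟨δ, hδ, Q, hQ, hroot⟩ := exists_polynomial_of_homogeneous hk
    (P := fun _ _ : Unit => -P) (fun i _ => hkP i) (fun y _ _ => if y = x then (μ x : ℂ) else 0)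
  refine exists_measureReal_law_Ioc_le _ hP hk hδ hQ fun u hu hunit => ?_
  set R := Ring.inverse (1 + u ^ k • P) with hR
  have hRP : R = 1 + u ^ k • (-P * R) := by
    have h := Ring.mul_inverse_cancel _ hunit
    rw [add_mul, one_mul, smul_mul_assoc] at h
    rw [neg_mul, smul_neg, ← sub_eq_add_neg, eq_sub_iff_add_eq]
    exact h
  rw [← hroot u hu (fun x _ _ => R (vac x)) ?_]
  · congr 1
    simp [cornerTrace_apply]
  · intro x i j
    conv_lhs => rw [hRP]
    simp

end FreeGraph

/-! ### Right multiplication operators -/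

namespace FreeGraph

universe u v

variable {V : Type u} {E : Type v} {G : Graph V E}

/-- The rank one operator `f ↦ ⟨y, f⟩ x` for two vertices `x` and `y`. -/
def vacRank (x y : V(G)) : Fock G →L[ℂ] Fock G := (pathCoeff y []).smulRight (vac x)

theorem vacRank_apply (x y : V(G)) (f : Fock G) : vacRank x y f = pathCoeff y [] f • vac x := rfl

theorem star_vacRank (x y : V(G)) : star (vacRank x y) = vacRank (G := G) y x := by
  rw [ContinuousLinearMap.star_eq_adjoint, eq_comm, ContinuousLinearMap.eq_adjoint_iff]
  intro f g
  rw [vacRank_apply, vacRank_apply, inner_smul_left, inner_smul_right, inner_vac,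
    ← inner_conj_symm f (vac x), inner_vac, mul_comm]

theorem star_vproj (x : V(G)) : star (vproj x) = vproj (G := G) x := by
  rw [ContinuousLinearMap.star_eq_adjoint, adjoint_vproj]

theorem vproj_mul_vproj_self (x : V(G)) : vproj x * vproj x = vproj (G := G) x := by
  classical
  ext1 f
  apply ext_pathCoeff
  intro y l
  simp only [mul_apply_eq_comp, pathCoeff_vproj]
  split_ifs <;> rfl

theorem vproj_mul_vproj_of_ne {x y : V(G)} (h : x ≠ y) : vproj x * vproj y = (0 : Fock G →L[ℂ] Fock G) := by
  classical
  ext1 f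
  apply ext_pathCoeff
  intro z l
  simp only [mul_apply_eq_comp, pathCoeff_vproj]
  split_ifs with h1 h2
  · exact absurd (h1.symm.trans h2) h
  · simp
  · simp

open Classical in
theorem rightAnn_mul_creation (ε d : OEdge G) : rightAnn ε * creation d =
    creation d * rightAnn ε + if d = ε then vacRank ε.src ε.tgt else 0 := by
  ext1 f
  rw [mul_apply_eq_comp, rightAnn_creation, add_apply, mul_apply_eq_comp]
  split_ifs <;> rfl

theorem rightAnn_mul_star_creation (ε d : OEdge G) :
    rightAnn ε * star (creation d) = star (creation d) * rightAnn ε := by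
  ext1 f
  exact rightAnn_adjoint_creation ε d f

theorem rightAnn_mul_vproj (ε : OEdge G) (x : V(G)) :
    rightAnn ε * vproj x = vproj x * rightAnn ε := by
  ext1 f
  exact rightAnn_vproj ε x f

open Classical in
theorem star_rightAnn_mul_star_creation (ε d : OEdge G) : star (creation d) * star (rightAnn ε) =
    star (rightAnn ε) * star (creation d) + if d = ε then vacRank ε.tgt ε.src else 0 := by
  have h := congrArg star (rightAnn_mul_creation ε d)
  rw [star_mul, star_add, star_mul] at h
  rw [h]
  split_ifs
  · rw [star_vacRank]
  · rw [star_zero]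

theorem star_rightAnn_mul_creation (ε d : OEdge G) :
    star (rightAnn ε) * creation d = creation d * star (rightAnn ε) := by
  have h := congrArg star (rightAnn_mul_star_creation ε d)
  rw [star_mul, star_mul, star_star] at h
  exact h.symm

theorem star_rightAnn_mul_vproj (ε : OEdge G) (x : V(G)) :
    star (rightAnn ε) * vproj x = vproj x * star (rightAnn ε) := by
  have h := congrArg star (rightAnn_mul_vproj ε x)
  rw [star_mul, star_mul, star_vproj] at h
  exact h.symm

variable {μ : V(G) → ℝ≥0}

theorem edgeWeight_pos (hμ : ∀ x, 0 < μ x) (ε : OEdge G) : 0 < edgeWeight μ ε :=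
  Real.rpow_pos_of_pos (div_pos (hμ _) (hμ _)) _

theorem edgeWeight_op (μ : V(G) → ℝ≥0) (ε : OEdge G) :
    edgeWeight μ ε.op = (edgeWeight μ ε)⁻¹ := by
  rw [edgeWeight, edgeWeight, ← Real.inv_rpow (by positivity), inv_div]
  rfl

theorem edgeWeight_pow_four (hμ : ∀ x, 0 < μ x) (ε : OEdge G) :
    μ ε.tgt * edgeWeight μ ε ^ 4 = μ ε.src := by
  have h : (0 : ℝ) < μ ε.tgt := hμ _
  rw [edgeWeight, ← Real.rpow_natCast, ← Real.rpow_mul (by positivity)]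
  norm_num
  field_simp

/-- The counterpart of `edgeOp` that acts on the right end of paths. -/
def rightOp (μ : V(G) → ℝ≥0) (ε : OEdge G) : Fock G →L[ℂ] Fock G :=
  ((edgeWeight μ ε)⁻¹ : ℂ) • star (rightAnn ε) + (edgeWeight μ ε : ℂ) • rightAnn ε.op

theorem star_rightOp (μ : V(G) → ℝ≥0) (ε : OEdge G) :
    star (rightOp μ ε) = rightOp μ ε.op := by
  rw [rightOp, rightOp, star_add, star_smul, star_smul, star_star, edgeWeight_op, OEdge.op_op,
    add_comm]
  simp

theorem edgeOp_eq (μ : V(G) → ℝ≥0) (ε : OEdge G) : edgeOp μ ε =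
    (edgeWeight μ ε : ℂ) • creation ε + ((edgeWeight μ ε)⁻¹ : ℂ) • star (creation ε.op) := rfl

/-- The commutator can be nonzero only for d = ε.op, where the two products differ from their normal
orderings by the same rank one operator. Its coefficient is 1 in both, because opposite edges have
inverse weights; hence the two corrections cancel. -/
theorem commute_rightOp_edgeOp (hμ : ∀ x, 0 < μ x) (ε d : OEdge G) :
    rightOp μ ε * edgeOp μ d = edgeOp μ d * rightOp μ ε := by
  classical
  have hε : (edgeWeight μ ε : ℂ) ≠ 0 := by exact_mod_cast (edgeWeight_pos hμ ε).ne'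
  rw [rightOp, edgeOp_eq]
  simp only [mul_add, add_mul, smul_mul_smul_comm, star_rightAnn_mul_creation,
    rightAnn_mul_creation, rightAnn_mul_star_creation, star_rightAnn_mul_star_creation]
  by_cases h : d = ε.op
  · subst h
    simp only [OEdge.op_op, if_true, edgeWeight_op, OEdge.src_op, OEdge.tgt_op]
    simp only [smul_add, Complex.ofReal_inv, inv_inv, mul_inv_cancel₀ hε, inv_mul_cancel₀ hε]
    abel
  · have h' : d.op ≠ ε := fun h' => h (OEdge.op_eq_iff.1 h')
    simp only [h, h', if_false, add_zero, mul_comm]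
    abel

/-- The operators that commute with the right multiplication operators. -/
def rightCommutant (μ : V(G) → ℝ≥0) : Subalgebra ℂ (Fock G →L[ℂ] Fock G) :=
  Subalgebra.centralizer ℂ (Set.range (rightOp μ))

theorem mem_rightCommutant {Z : Fock G →L[ℂ] Fock G} :
    Z ∈ rightCommutant μ ↔ ∀ ε, rightOp μ ε * Z = Z * rightOp μ ε := by
  rw [rightCommutant, Subalgebra.mem_centralizer_iff, Set.forall_mem_range]

theorem vproj_mem_rightCommutant (x : V(G)) : vproj x ∈ rightCommutant μ := by
  rw [mem_rightCommutant]
  intro ε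
  simp only [rightOp, add_mul, mul_add, smul_mul_assoc, mul_smul_comm, star_rightAnn_mul_vproj,
    rightAnn_mul_vproj]

theorem polyAlg_le_rightCommutant (hμ : ∀ x, 0 < μ x) : polyAlg μ ≤ rightCommutant μ := by
  refine Algebra.adjoin_le ?_
  rintro _ (⟨d, rfl⟩ | ⟨x, rfl⟩)
  · exact mem_rightCommutant.2 fun ε => commute_rightOp_edgeOp hμ ε d
  · exact vproj_mem_rightCommutant x

theorem star_mem_rightCommutant {Z : Fock G →L[ℂ] Fock G} (hZ : Z ∈ rightCommutant μ) :
    star Z ∈ rightCommutant μ := by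
  rw [mem_rightCommutant] at hZ ⊢
  intro ε
  have h := congrArg star (hZ ε.op)
  rw [star_mul, star_mul, star_rightOp, OEdge.op_op] at h
  exact h.symm

theorem ringInverse_mem_rightCommutant {Z : Fock G →L[ℂ] Fock G} (hZ : Z ∈ rightCommutant μ) :
    Ring.inverse Z ∈ rightCommutant μ := by
  by_cases h : IsUnit Z
  · obtain ⟨z, rfl⟩ := h
    rw [mem_rightCommutant] at hZ ⊢
    rw [Ring.inverse_unit]
    intro ε
    exact (Commute.units_inv_right (u := z) (hZ ε)).eq
  · rw [Ring.inverse_non_unit _ h]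
    exact zero_mem _

/-- The vacuum vector of `x` is separating: an operator in the commutant that has no component at
the path of length zero at `x` has no component at the paths that start at `x`. -/
theorem pathCoeff_eq_zero_of_mem_rightCommutant (hμ : ∀ x, 0 < μ x) {Z : Fock G →L[ℂ] Fock G}
    (hZ : Z ∈ rightCommutant μ) {x : V(G)} (h : ∀ ζ, pathCoeff x [] (Z ζ) = 0) :
    vproj x * Z = 0 := by
  classical
  have key : ∀ n, ∀ l : List (OEdge G), l.length < n → ∀ ζ, pathCoeff x l (Z ζ) = 0 := by
    intro n
    induction n with
    | zero => intro l hl; omega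
    | succ n ih =>
      intro l hl ζ
      rcases List.eq_nil_or_concat' l with rfl | ⟨m, ε, rfl⟩
      · exact h ζ
      · rw [List.length_append] at hl
        simp only [List.length_singleton] at hl
        -- Moving `rightOp μ ε.op` across Z expresses the coordinate at m as a nonzero multiple of
        -- the coordinate at m ++ [ε] plus a coordinate at a path shorter than m, which vanishes by
        -- induction.
        have h1 := ih m (by omega) (rightOp μ ε.op ζ)
        have h2 : Z (rightOp μ ε.op ζ) = rightOp μ ε.op (Z ζ) := by
          rw [← mul_apply_eq_comp, ← mul_apply_eq_comp, mem_rightCommutant.1 hZ]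
        rw [h2, rightOp, add_apply, smul_apply, smul_apply, map_add, map_smul, map_smul,
          OEdge.op_op, pathCoeff_rightAnn] at h1
        have h3 : pathCoeff x m (star (rightAnn ε.op) (Z ζ)) = 0 := by
          rw [ContinuousLinearMap.star_eq_adjoint]
          rcases List.eq_nil_or_concat' m with rfl | ⟨m', d, rfl⟩
          · exact pathCoeff_nil_adjoint_rightAnn _ _ _
          · rw [pathCoeff_append_adjoint_rightAnn]
            split_ifs
            · rw [List.length_append] at hl
              exact ih m' (by omega) ζ
            · rfl
        rw [h3, smul_zero, zero_add, smul_eq_zero] at h1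
        refine h1.resolve_left ?_
        exact_mod_cast (edgeWeight_pos hμ ε.op).ne'
  ext1 ζ
  apply ext_pathCoeff
  intro y l
  rw [mul_apply_eq_comp, pathCoeff_vproj]
  split_ifs with hy
  · subst hy
    rw [key _ l (Nat.lt_succ_self _)]
    simp
  · simp

/-! ### The trace property -/

theorem star_creation_vac (ε : OEdge G) (x : V(G)) : star (creation ε) (vac x) = 0 := by
  classical
  apply ext_pathCoeff
  intro y l
  rw [ContinuousLinearMap.star_eq_adjoint, pathCoeff_adjoint_creation]
  simp [pathCoeff_vac]

/-- A one-edge path arises from a vertex by adding the edge on the left or on the right. This is how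
left operators at the vacuum become right ones. -/
theorem creation_vac (ε : OEdge G) : creation ε (vac ε.tgt) = star (rightAnn ε) (vac ε.src) := by
  classical
  apply ext_pathCoeff
  intro y l
  rw [ContinuousLinearMap.star_eq_adjoint]
  rcases List.eq_nil_or_concat' l with rfl | ⟨m, d, rfl⟩
  · rw [pathCoeff_nil_adjoint_rightAnn, pathCoeff_nil_creation]
  · rw [pathCoeff_append_adjoint_rightAnn, pathCoeff_vac]
    cases m with
    | nil =>
      rw [List.nil_append, pathCoeff_cons_creation, pathCoeff_vac]
      by_cases h1 : d = ε
      · by_cases h2 : y = ε.src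
        · rw [if_pos ⟨h1, h2⟩, if_pos ⟨rfl, rfl⟩, if_pos ⟨h1, h2.symm, trivial⟩, if_pos ⟨h2, rfl⟩]
        · rw [if_neg fun h => h2 h.2, if_neg fun h => h2 h.2.1.symm]
      · rw [if_neg fun h => h1 h.1, if_neg fun h => h1 h.1]
    | cons c m =>
      rw [List.cons_append, pathCoeff_cons_creation, pathCoeff_vac]
      simp

theorem creation_vac_of_ne {ε : OEdge G} {x : V(G)} (h : ε.tgt ≠ x) : creation ε (vac x) = 0 := by
  classical
  apply ext_pathCoeff
  intro y l
  cases l with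
  | nil => rw [pathCoeff_nil_creation, map_zero]
  | cons c m =>
    rw [pathCoeff_cons_creation, pathCoeff_vac]
    simp [h]

variable [Fintype V(G)]

/-- On the vacuum at the target, `edgeOp μ ε` is a² times `rightOp μ ε` on the vacuum at the source,
and the latter moves past Z. Both traces become multiples of one coefficient z, namely μ(s) a⁻¹ z
and μ(t) a³ z; they agree precisely because a⁴ = μ(s)/μ(t). -/
theorem trace_edgeOp_mul (hμ : ∀ x, 0 < μ x) (ε : OEdge G) {Z : Fock G →L[ℂ] Fock G}
    (hZ : Z ∈ rightCommutant μ) : trace μ (edgeOp μ ε * Z) = trace μ (Z * edgeOp μ ε) := by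
  classical
  have ha : (edgeWeight μ ε : ℂ) ≠ 0 := by exact_mod_cast (edgeWeight_pos hμ ε).ne'
  set z := pathCoeff ε.tgt [] (rightAnn ε.op (Z (vac ε.src))) with hz
  have hX : ∀ x, pathCoeff x [] ((edgeOp μ ε * Z) (vac x)) = (edgeWeight μ ε : ℂ)⁻¹ *
      if x = ε.src then pathCoeff ε.tgt [ε.op] (Z (vac x)) else 0 := by
    intro x
    rw [mul_apply_eq_comp, edgeOp_eq, add_apply, smul_apply, smul_apply, map_add, map_smul,
      map_smul, pathCoeff_nil_creation, ContinuousLinearMap.star_eq_adjoint,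
      pathCoeff_adjoint_creation, smul_zero, zero_add]
    rfl
  have h1 : trace μ (edgeOp μ ε * Z) = μ ε.src * ((edgeWeight μ ε : ℂ)⁻¹ * z) := by
    rw [trace_apply, Finset.sum_eq_single ε.src]
    · rw [hX, if_pos rfl, hz, pathCoeff_rightAnn, List.nil_append]
    · intro x _ hx
      rw [hX, if_neg hx, mul_zero, mul_zero]
    · simp
  have h2 : edgeOp μ ε (vac ε.tgt) = (edgeWeight μ ε : ℂ) ^ 2 • rightOp μ ε (vac ε.src) := by
    rw [edgeOp_eq, rightOp, add_apply, add_apply, smul_apply, smul_apply, smul_apply, smul_apply,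
      star_creation_vac, rightAnn_vac, creation_vac, smul_zero, smul_zero, add_zero, add_zero,
      smul_smul]
    congr 1
    field_simp
  have h3 : trace μ (Z * edgeOp μ ε) = μ ε.tgt * ((edgeWeight μ ε : ℂ) ^ 3 * z) := by
    rw [trace_apply, Finset.sum_eq_single ε.tgt]
    · rw [mul_apply_eq_comp, h2, map_smul, map_smul, ← mul_apply_eq_comp, ← mem_rightCommutant.1 hZ,
        mul_apply_eq_comp, rightOp, add_apply, smul_apply, smul_apply, map_add, map_smul, map_smul,
        ContinuousLinearMap.star_eq_adjoint, pathCoeff_nil_adjoint_rightAnn, ← hz]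
      simp only [smul_eq_mul, mul_zero, zero_add]
      ring
    · intro x _ hx
      rw [mul_apply_eq_comp, edgeOp_eq, add_apply, smul_apply, smul_apply,
        creation_vac_of_ne (Ne.symm hx), star_creation_vac]
      simp
    · simp
  have h4 : (μ ε.tgt : ℂ) * (edgeWeight μ ε : ℂ) ^ 4 = μ ε.src := by
    exact_mod_cast congrArg (Complex.ofReal) (edgeWeight_pow_four hμ ε)
  rw [h1, h3, ← h4]
  field_simp

theorem trace_vproj_mul (x : V(G)) (Z : Fock G →L[ℂ] Fock G) :
    trace μ (vproj x * Z) = trace μ (Z * vproj x) := by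
  classical
  rw [trace_apply, trace_apply]
  refine Finset.sum_congr rfl fun y _ => ?_
  rw [mul_apply_eq_comp, mul_apply_eq_comp, pathCoeff_vproj]
  by_cases h : y = x
  · subst h
    rw [if_pos rfl, vproj_vac]
  · rw [if_neg h, vproj_vac_of_ne h]
    simp

/-- It is enough to move one generator at a time, since the remaining factors stay in the commutant,
which contains the algebra. -/
theorem trace_mul_comm (hμ : ∀ x, 0 < μ x) {P : Fock G →L[ℂ] Fock G} (hP : P ∈ polyAlg μ)
    {Z : Fock G →L[ℂ] Fock G} (hZ : Z ∈ rightCommutant μ) :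
    trace μ (P * Z) = trace μ (Z * P) := by
  induction hP using Algebra.adjoin_induction generalizing Z with
  | mem P hP =>
    rcases hP with ⟨ε, rfl⟩ | ⟨x, rfl⟩
    · exact trace_edgeOp_mul hμ ε hZ
    · exact trace_vproj_mul x Z
  | algebraMap c => rw [Algebra.commutes]
  | add P Q _ _ hP hQ => rw [add_mul, mul_add, map_add, map_add, hP hZ, hQ hZ]
  | mul P Q hPA hQA hP hQ =>
    have hP' := polyAlg_le_rightCommutant hμ hPA
    have hQ' := polyAlg_le_rightCommutant hμ hQA
    rw [mul_assoc, hP (mul_mem hQ' hZ), mul_assoc, hQ (mul_mem hZ hP'), mul_assoc]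

end FreeGraph

/-! ### Resolvents of positive operators at infinity -/

section Hilbert

variable {H : Type*} [NormedAddCommGroup H] [InnerProductSpace ℂ H] [CompleteSpace H]
  {A : H →L[ℂ] H}

theorem ringInverse_one_add_smul_apply_add (hA : 0 ≤ A) {s : ℝ} (hs : 0 ≤ s) (x : H) :
    Ring.inverse (1 + (s : ℂ) • A) x + (s : ℂ) • A (Ring.inverse (1 + (s : ℂ) • A) x) = x := by
  have h := congrArg (fun T : H →L[ℂ] H => T x)
    (Ring.mul_inverse_cancel _ (isUnit_one_add_coe_smul hA hs))
  exact h

theorem ringInverse_one_add_smul_apply_self_add (hA : 0 ≤ A) {s : ℝ} (hs : 0 ≤ s) (x : H) :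
    Ring.inverse (1 + (s : ℂ) • A) (x + (s : ℂ) • A x) = x := by
  have h := congrArg (fun T : H →L[ℂ] H => T x)
    (Ring.inverse_mul_cancel _ (isUnit_one_add_coe_smul hA hs))
  exact h

/-- Pair x = y + s A y with the resolvent vector y and drop the nonnegative term s⟨y, A y⟩. -/
theorem sq_norm_ringInverse_one_add_smul_le (hA : 0 ≤ A) {s : ℝ} (hs : 0 ≤ s) (x : H) :
    ‖Ring.inverse (1 + (s : ℂ) • A) x‖ ^ 2 ≤ (inner ℂ (Ring.inverse (1 + (s : ℂ) • A) x) x : ℂ).re := by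
  set y := Ring.inverse (1 + (s : ℂ) • A) x with hy
  have h : (inner ℂ y x : ℂ) = inner ℂ y y + s * inner ℂ y (A y) := by
    conv_lhs => rw [← ringInverse_one_add_smul_apply_add hA hs x, ← hy]
    rw [inner_add_right, inner_smul_right]
  have h1 : 0 ≤ (inner ℂ y (A y) : ℂ).re :=
    ((ContinuousLinearMap.nonneg_iff_isPositive A).1 hA).re_inner_nonneg_right y
  rw [h, inner_self_eq_norm_sq_to_K, Complex.add_re, Complex.re_ofReal_mul]
  have h2 : (((‖y‖ : ℝ) : ℂ) ^ 2).re = ‖y‖ ^ 2 := by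
    rw [← Complex.ofReal_pow, Complex.ofReal_re]
  have h3 := mul_nonneg hs h1
  change _ ≤ (((‖y‖ : ℝ) : ℂ) ^ 2).re + _
  rw [h2]
  linarith

theorem norm_ringInverse_one_add_smul_apply_le (hA : 0 ≤ A) {s : ℝ} (hs : 0 ≤ s) (x : H) :
    ‖Ring.inverse (1 + (s : ℂ) • A) x‖ ≤ ‖x‖ := by
  set y := Ring.inverse (1 + (s : ℂ) • A) x with hy
  have h1 := sq_norm_ringInverse_one_add_smul_le hA hs x
  rw [← hy] at h1
  have h2 : (inner ℂ y x : ℂ).re ≤ ‖y‖ * ‖x‖ := re_inner_le_norm (𝕜 := ℂ) y x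
  rcases (norm_nonneg y).eq_or_lt with h | h
  · rw [← h]
    exact norm_nonneg x
  · refine le_of_mul_le_mul_left ?_ h
    rw [← sq]
    exact h1.trans h2

/-- On a vector A y the resolvent is s⁻¹ times y minus its resolvent, hence of norm at most 2‖y‖/s.
Contractivity extends the convergence to the closure of the range. -/
theorem tendsto_ringInverse_one_add_smul_apply (hA : 0 ≤ A) {x : H}
    (hx : x ∈ closure (Set.range A)) :
    Tendsto (fun s : ℝ => Ring.inverse (1 + (s : ℂ) • A) x) atTop (𝓝 0) := by
  rw [Metric.tendsto_nhds]
  intro ε hε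
  obtain ⟨_, ⟨y, rfl⟩, hy⟩ := Metric.mem_closure_iff.1 hx (ε / 2) (by positivity)
  filter_upwards [eventually_gt_atTop 0, eventually_gt_atTop (4 * (‖y‖ + 1) / ε)] with s hs hs'
  rw [dist_zero_right]
  have h1 : Ring.inverse (1 + (s : ℂ) • A) (A y) = (s : ℂ)⁻¹ • (y - Ring.inverse (1 + (s : ℂ) • A) y) := by
    have h2 := ringInverse_one_add_smul_apply_self_add hA hs.le y
    rw [map_add, map_smul] at h2
    rw [eq_inv_smul_iff₀ (by exact_mod_cast hs.ne'), eq_sub_iff_add_eq']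
    exact h2
  have h2 : ‖Ring.inverse (1 + (s : ℂ) • A) (A y)‖ ≤ s⁻¹ * (2 * ‖y‖) := by
    rw [h1, norm_smul, norm_inv, Complex.norm_real, Real.norm_of_nonneg hs.le]
    gcongr
    refine (norm_sub_le _ _).trans ?_
    linarith [norm_ringInverse_one_add_smul_apply_le hA hs.le y]
  have h3 : ‖Ring.inverse (1 + (s : ℂ) • A) (x - A y)‖ < ε / 2 :=
    (norm_ringInverse_one_add_smul_apply_le hA hs.le _).trans_lt (by rwa [← dist_eq_norm])
  have h4 : s⁻¹ * (2 * ‖y‖) < ε / 2 := by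
    rw [inv_mul_lt_iff₀ hs]
    rw [div_lt_iff₀ hε] at hs'
    linarith
  calc ‖Ring.inverse (1 + (s : ℂ) • A) x‖
      = ‖Ring.inverse (1 + (s : ℂ) • A) (x - A y) + Ring.inverse (1 + (s : ℂ) • A) (A y)‖ := by
        rw [← map_add, sub_add_cancel]
    _ ≤ _ := norm_add_le _ _
    _ < ε := by linarith

theorem tendsto_ringInverse_of_starProjection_ker (hA : 0 ≤ A) {x : H}
    (hx : A.ker.starProjection x = 0) :
    Tendsto (fun s : ℝ => Ring.inverse (1 + (s : ℂ) • A) x) atTop (𝓝 0) := by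
  apply tendsto_ringInverse_one_add_smul_apply hA
  have h1 : x ∈ A.kerᗮ := by
    have := Submodule.sub_starProjection_mem_orthogonal (K := A.ker) x
    rwa [hx, sub_zero] at this
  have h2 : A.rangeᗮ = A.ker := by
    have h := ContinuousLinearMap.orthogonal_range A
    have hsa : ContinuousLinearMap.adjoint A = A := (IsSelfAdjoint.of_nonneg hA)
    rwa [hsa] at h
  rw [← h2, Submodule.orthogonal_orthogonal_eq_closure] at h1
  exact h1

theorem starProjection_apply_comm {K : Submodule ℂ H} [K.HasOrthogonalProjection] {T : H →L[ℂ] H}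
    (hT : ∀ x ∈ K, T x ∈ K) (hT' : ∀ x ∈ K, star T x ∈ K) :
    K.starProjection * T = T * K.starProjection := by
  ext1 x
  refine Submodule.eq_starProjection_of_mem_orthogonal
    (hT _ (Submodule.starProjection_apply_mem K x)) ?_
  change T x - T (K.starProjection x) ∈ Kᗮ
  rw [← map_sub, Submodule.mem_orthogonal]
  intro y hy
  rw [← ContinuousLinearMap.adjoint_inner_left]
  exact (Submodule.mem_orthogonal _ _).1 (Submodule.sub_starProjection_mem_orthogonal x) _
    (hT' y hy)

end Hilbert

/-! ### Rank-nullity between corners, from the trace -/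

namespace FreeGraph

universe u v

variable {V : Type u} {E : Type v} {G : Graph V E} {μ : V(G) → ℝ≥0}

theorem star_edgeOp (μ : V(G) → ℝ≥0) (ε : OEdge G) : star (edgeOp μ ε) = edgeOp μ ε.op := by
  rw [edgeOp_eq, edgeOp_eq, star_add, star_smul, star_smul, star_star, edgeWeight_op, OEdge.op_op,
    add_comm]
  simp

theorem ringInverse_one_add_mem_rightCommutant {Q : Fock G →L[ℂ] Fock G}
    (hQ : Q ∈ rightCommutant μ) (s : ℝ) : Ring.inverse (1 + (s : ℂ) • Q) ∈ rightCommutant μ := by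
  exact ringInverse_mem_rightCommutant (add_mem (one_mem _) (Subalgebra.smul_mem _ hQ _))

variable [Fintype V(G)]

theorem trace_vproj_mul_eq (x : V(G)) (T : Fock G →L[ℂ] Fock G) :
    trace μ (vproj x * T) = μ x * pathCoeff x [] (T (vac x)) := by
  classical
  rw [trace_apply, Finset.sum_eq_single x]
  · rw [mul_apply_eq_comp, pathCoeff_vproj, if_pos rfl]
  · intro y _ hy
    rw [mul_apply_eq_comp, pathCoeff_vproj, if_neg hy, mul_zero]
  · simp

/-- A resolvent form of rank-nullity: (1+sPP*)⁻¹ = 1 - sP(1+sP*P)⁻¹P*, and cyclicity of the trace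
moves P to the other side. As s tends to infinity the two resolvents tend to the kernel projections
of P* and P. -/
theorem mul_pathCoeff_ringInverse_eq (hμ : ∀ x, 0 < μ x) {x y : V(G)}
    {P : Fock G →L[ℂ] Fock G} (hPA : P ∈ polyAlg μ) (hP : vproj y * P * vproj x = P) {s : ℝ}
    (hs : 0 ≤ s) :
    (μ y : ℂ) * pathCoeff y [] (Ring.inverse (1 + (s : ℂ) • (P * star P)) (vac y)) =
      μ y - μ x + μ x * pathCoeff x [] (Ring.inverse (1 + (s : ℂ) • (star P * P)) (vac x)) := by
  classical
  have hPy : vproj y * P = P := by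
    rw [← hP, ← mul_assoc, ← mul_assoc, vproj_mul_vproj_self]
  have hPx : P * vproj x = P := by
    rw [← hP, mul_assoc, vproj_mul_vproj_self]
  set R := Ring.inverse (1 + (s : ℂ) • (star P * P)) with hR
  have hPR : P ∈ rightCommutant μ := polyAlg_le_rightCommutant hμ hPA
  have hRR : R ∈ rightCommutant μ :=
    ringInverse_one_add_mem_rightCommutant (mul_mem (star_mem_rightCommutant hPR) hPR) s
  have hu := isUnit_one_add_coe_smul (star_mul_self_nonneg P) hs
  have hu' := isUnit_one_add_coe_smul (mul_star_self_nonneg P) hs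
  have h1 : R + (s : ℂ) • (star P * P * R) = 1 := by
    have := Ring.mul_inverse_cancel _ hu
    rwa [add_mul, one_mul, smul_mul_assoc] at this
  have h1' : R + (s : ℂ) • (R * star P * P) = 1 := by
    have := Ring.inverse_mul_cancel _ hu
    rwa [mul_add, mul_one, mul_smul_comm, ← mul_assoc] at this
  have h2 : Ring.inverse (1 + (s : ℂ) • (P * star P)) = 1 - (s : ℂ) • (P * R * star P) := by
    have h3 : (1 + (s : ℂ) • (P * star P)) * (1 - (s : ℂ) • (P * R * star P)) = 1 := by
      have h4 : (s : ℂ) • (star P * P * R) = 1 - R := eq_sub_of_add_eq' h1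
      have h5 : (s : ℂ) • (P * star P) * ((s : ℂ) • (P * R * star P)) =
          (s : ℂ) • (P * ((s : ℂ) • (star P * P * R)) * star P) := by
        simp only [smul_mul_assoc, mul_smul_comm, mul_assoc]
      rw [add_mul, one_mul, mul_sub, mul_one, h5, h4, mul_sub, mul_one, sub_mul, smul_sub]
      abel
    calc Ring.inverse (1 + (s : ℂ) • (P * star P)) = Ring.inverse (1 + (s : ℂ) • (P * star P)) *
          ((1 + (s : ℂ) • (P * star P)) * (1 - (s : ℂ) • (P * R * star P))) := by rw [h3, mul_one]
      _ = _ := by rw [← mul_assoc, Ring.inverse_mul_cancel _ hu', one_mul]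
  have h6 : (μ y : ℂ) * pathCoeff y [] ((P * R * star P) (vac y)) =
      μ x * pathCoeff x [] ((R * star P * P) (vac x)) := by
    rw [← trace_vproj_mul_eq, ← trace_vproj_mul_eq, trace_vproj_mul x, mul_assoc (R * star P), hPx,
      ← mul_assoc, ← mul_assoc, hPy, mul_assoc,
      trace_mul_comm hμ hPA (mul_mem hRR (star_mem_rightCommutant hPR))]
  have h7 : ∀ z : V(G), pathCoeff z [] (vac z) = 1 := by
    intro z
    rw [pathCoeff_vac, if_pos ⟨rfl, rfl⟩]
  have h8 : (s : ℂ) * pathCoeff x [] ((R * star P * P) (vac x)) =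
      1 - pathCoeff x [] (R (vac x)) := by
    have := congrArg (fun T : Fock G →L[ℂ] Fock G => pathCoeff x [] (T (vac x))) h1'
    rw [add_apply, smul_apply, map_add, map_smul, one_apply_eq_self, h7,
      smul_eq_mul] at this
    exact eq_sub_of_add_eq' this
  rw [h2, sub_apply, smul_apply, map_sub, map_smul, one_apply_eq_self, h7,
    smul_eq_mul, mul_sub, mul_left_comm, h6, mul_left_comm, h8]
  ring

/-- If `P` from the corner at `x` to the corner at `y` has a kernel, and the weight of `y` is not
less than the weight of `x`, then the range of `P` is not dense. -/
theorem exists_star_apply_eq_zero (hμ : ∀ x, 0 < μ x) {x y : V(G)} (hxy : μ x ≤ μ y)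
    {P : Fock G →L[ℂ] Fock G} (hPA : P ∈ polyAlg μ) (hP : vproj y * P * vproj x = P)
    {w : Fock G →L[ℂ] Fock G} (hw : w ∈ rightCommutant μ) (hw0 : w ≠ 0) (hwx : vproj x * w = w)
    (hPw : P * w = 0) : ∃ ξ, star P ξ = 0 ∧ pathCoeff y [] ξ ≠ 0 := by
  by_contra! hcon
  have hA : (0 : Fock G →L[ℂ] Fock G) ≤ P * star P := mul_star_self_nonneg P
  have hB : (0 : Fock G →L[ℂ] Fock G) ≤ star P * P := star_mul_self_nonneg P
  -- The contrary assumption says that the kernel of P*, which is that of PP*, is orthogonal to the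
  -- vacuum at y.
  have hproj : (P * star P).ker.starProjection (vac y) = 0 := by
    set ξ := (P * star P).ker.starProjection (vac y) with hξ
    have h1 : (P * star P) ξ = 0 :=
      Submodule.starProjection_apply_mem (P * star P).ker (vac y)
    have h2 : star P ξ = 0 := by
      rw [← inner_self_eq_zero (𝕜 := ℂ)]
      nth_rw 1 [ContinuousLinearMap.star_eq_adjoint]
      rw [ContinuousLinearMap.adjoint_inner_left]
      rw [mul_apply_eq_comp] at h1
      rw [h1, inner_zero_right]
    have h3 := hcon ξ h2
    rw [← inner_vac] at h3
    rw [← inner_self_eq_zero (𝕜 := ℂ)]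
    nth_rw 1 [hξ]
    rw [Submodule.inner_starProjection_left_eq_right, Submodule.starProjection_eq_self_iff.2]
    · exact h3
    · exact Submodule.starProjection_apply_mem _ (vac y)
  have hlim := tendsto_ringInverse_of_starProjection_ker hA hproj
  have hlim1 : Tendsto (fun s : ℝ => μ y / μ x *
      ‖pathCoeff y [] (Ring.inverse (1 + (s : ℂ) • (P * star P)) (vac y))‖) atTop (𝓝 0) := by
    have := (((pathCoeff y []).continuous.tendsto 0).comp hlim).norm.const_mul ((μ y : ℝ) / μ x)
    simpa using this
  -- The rank-nullity identity is used with the nonnegative term μ y - μ x dropped; this is where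
  -- the order of the weights enters.
  have hbound : ∀ s : ℝ, 0 ≤ s → ‖Ring.inverse (1 + (s : ℂ) • (star P * P)) (vac x)‖ ^ 2 ≤
      μ y / μ x * ‖pathCoeff y [] (Ring.inverse (1 + (s : ℂ) • (P * star P)) (vac y))‖ := by
    intro s hs
    refine (sq_norm_ringInverse_one_add_smul_le hB hs (vac x)).trans ?_
    rw [← inner_conj_symm, Complex.conj_re, inner_vac, div_mul_eq_mul_div, le_div_iff₀' (by exact_mod_cast hμ x)]
    have h1 := congrArg Complex.re (mul_pathCoeff_ringInverse_eq hμ hPA hP hs)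
    rw [Complex.add_re, Complex.sub_re, Complex.re_ofReal_mul, Complex.re_ofReal_mul,
      Complex.ofReal_re, Complex.ofReal_re] at h1
    have h2 : (μ x : ℝ) ≤ μ y := hxy
    have h3 := mul_le_mul_of_nonneg_left
      (Complex.re_le_norm (pathCoeff y [] (Ring.inverse (1 + (s : ℂ) • (P * star P)) (vac y))))
      (μ y).coe_nonneg
    rw [h1] at h3
    exact le_trans (le_add_of_nonneg_left (sub_nonneg.2 h2)) h3
  have hlim2 : Tendsto (fun s : ℝ => Ring.inverse (1 + (s : ℂ) • (star P * P)) (vac x)) atTop (𝓝 0) := by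
    rw [tendsto_zero_iff_norm_tendsto_zero]
    have h1 : Tendsto (fun s : ℝ => ‖Ring.inverse (1 + (s : ℂ) • (star P * P)) (vac x)‖ ^ 2) atTop
        (𝓝 0) := by
      refine tendsto_of_tendsto_of_tendsto_of_le_of_le' tendsto_const_nhds hlim1 ?_ ?_
      · exact Eventually.of_forall fun s => by positivity
      · filter_upwards [eventually_ge_atTop 0] with s hs using hbound s hs
    have h2 := h1.sqrt
    simpa using h2
  apply hw0
  rw [← hwx]
  refine pathCoeff_eq_zero_of_mem_rightCommutant hμ hw fun ζ => ?_
  -- The resolvents of P*P fix the range of w, yet send the vacuum at x to zero in the limit. So the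
  -- range of w is orthogonal to that vacuum, and w vanishes because the vacuum is separating.
  have h3 : ∀ s : ℝ, 0 ≤ s → Ring.inverse (1 + (s : ℂ) • (star P * P)) (w ζ) = w ζ := by
    intro s hs
    have h4 := ringInverse_one_add_smul_apply_self_add hB hs (w ζ)
    have h5 : (star P * P) (w ζ) = 0 := by
      rw [mul_apply_eq_comp, ← mul_apply_eq_comp P w, hPw]
      simp
    rwa [h5, smul_zero, add_zero] at h4
  have h6 : Tendsto (fun s : ℝ => (inner ℂ (Ring.inverse (1 + (s : ℂ) • (star P * P)) (vac x)) (w ζ) : ℂ))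
      atTop (𝓝 0) := by
    have := hlim2.inner (𝕜 := ℂ) (tendsto_const_nhds (x := w ζ))
    rwa [inner_zero_left] at this
  have h7 : (fun s : ℝ => (inner ℂ (Ring.inverse (1 + (s : ℂ) • (star P * P)) (vac x)) (w ζ) : ℂ))
      =ᶠ[atTop] fun _ => pathCoeff x [] (w ζ) := by
    filter_upwards [eventually_ge_atTop 0] with s hs
    have h8 : IsSelfAdjoint (Ring.inverse (1 + (s : ℂ) • (star P * P))) :=
      IsSelfAdjoint.of_nonneg (ringInverse_one_add_smul_nonneg hB hs)
    rw [← h8.star_eq, ContinuousLinearMap.star_eq_adjoint, ContinuousLinearMap.adjoint_inner_left,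
      h3 s hs, inner_vac]
  exact tendsto_nhds_unique (tendsto_const_nhds.congr' h7.symm) h6

end FreeGraph

/-! ### Polynomials of bounded degree -/

namespace FreeGraph

universe u v

variable {V : Type u} {E : Type v} {G : Graph V E} {μ : V(G) → ℝ≥0}

theorem vproj_mul_edgeOp_src (ε : OEdge G) :
    vproj ε.src * edgeOp μ ε = edgeOp μ ε := by
  classical
  ext1 f
  apply ext_pathCoeff
  intro y l
  rw [mul_apply_eq_comp, pathCoeff_vproj]
  split_ifs with h
  · rfl
  · rw [edgeOp, add_apply, smul_apply, smul_apply, map_add, map_smul, map_smul,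
      pathCoeff_adjoint_creation, OEdge.tgt_op, if_neg h]
    cases l with
    | nil => simp
    | cons d l => simp [pathCoeff_cons_creation, h]

theorem edgeOp_mul_vproj_tgt (ε : OEdge G) :
    edgeOp μ ε * vproj ε.tgt = edgeOp μ ε := by
  have h := congrArg star (vproj_mul_edgeOp_src (μ := μ) ε.op)
  rwa [star_mul, star_edgeOp, star_vproj, OEdge.op_op, OEdge.src_op] at h

theorem vproj_mul_edgeOp_of_ne {ε : OEdge G} {x : V(G)} (h : x ≠ ε.src) :
    vproj x * edgeOp μ ε = 0 := by
  rw [← vproj_mul_edgeOp_src, ← mul_assoc, vproj_mul_vproj_of_ne h, zero_mul]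

/-- The linear combinations of the products of fewer than `d` of the operators `edgeOp μ ε` and a
vertex projection. -/
def degreeLT (μ : V(G) → ℝ≥0) : ℕ → Submodule ℂ (Fock G →L[ℂ] Fock G)
  | 0 => ⊥
  | d + 1 => Submodule.span ℂ (Set.range vproj) ⊔
      ⨆ ε, (degreeLT μ d).map (LinearMap.mulLeft ℂ (edgeOp μ ε))

theorem vproj_mem_degreeLT (x : V(G)) (d : ℕ) : vproj x ∈ degreeLT μ (d + 1) :=
  Submodule.mem_sup_left (Submodule.subset_span ⟨x, rfl⟩)

theorem edgeOp_mul_mem_degreeLT (ε : OEdge G) {d : ℕ} {Q : Fock G →L[ℂ] Fock G}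
    (hQ : Q ∈ degreeLT μ d) : edgeOp μ ε * Q ∈ degreeLT μ (d + 1) :=
  Submodule.mem_sup_right (Submodule.mem_iSup_of_mem ε ⟨Q, hQ, rfl⟩)

theorem degreeLT_mono : Monotone (degreeLT μ) := by
  refine monotone_nat_of_le_succ fun d => ?_
  induction d with
  | zero => exact bot_le
  | succ d ih => exact sup_le_sup_left (iSup_mono fun ε => Submodule.map_mono ih) _

variable [Fintype V(G)] [Fintype (OEdge G)]

theorem mem_degreeLT_succ {d : ℕ} {P : Fock G →L[ℂ] Fock G} : P ∈ degreeLT μ (d + 1) ↔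
    ∃ (c : V(G) → ℂ) (Q : OEdge G → Fock G →L[ℂ] Fock G), (∀ ε, Q ε ∈ degreeLT μ d) ∧
      P = ∑ x, c x • vproj x + ∑ ε, edgeOp μ ε * Q ε := by
  constructor
  · intro h
    rw [degreeLT, Submodule.mem_sup] at h
    obtain ⟨S, hS, T, hT, rfl⟩ := h
    obtain ⟨c, rfl⟩ := (Submodule.mem_span_range_iff_exists_fun ℂ).1 hS
    obtain ⟨f, hf, rfl⟩ := (Submodule.mem_iSup_iff_exists_finsupp _ _).1 hT
    choose Q hQ hQf using hf
    refine ⟨c, Q, hQ, ?_⟩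
    rw [Finsupp.sum_fintype _ _ fun _ => rfl]
    congr 1
    exact Finset.sum_congr rfl fun ε _ => (hQf ε).symm
  · rintro ⟨c, Q, hQ, rfl⟩
    exact add_mem (sum_mem fun x _ => Submodule.smul_mem _ _ (vproj_mem_degreeLT x d))
      (sum_mem fun ε _ => edgeOp_mul_mem_degreeLT ε (hQ ε))

theorem vproj_mul_mem_degreeLT (x : V(G)) {d : ℕ} {P : Fock G →L[ℂ] Fock G}
    (hP : P ∈ degreeLT μ d) : vproj x * P ∈ degreeLT μ d := by
  cases d with
  | zero =>
    rw [degreeLT, Submodule.mem_bot] at hP ⊢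
    rw [hP, mul_zero]
  | succ d =>
    obtain ⟨c, Q, hQ, rfl⟩ := mem_degreeLT_succ.1 hP
    rw [mul_add, Finset.mul_sum, Finset.mul_sum]
    refine add_mem (sum_mem fun y _ => ?_) (sum_mem fun ε _ => ?_)
    · rw [mul_smul_comm]
      refine Submodule.smul_mem _ _ ?_
      by_cases h : x = y
      · subst h
        rw [vproj_mul_vproj_self]
        exact vproj_mem_degreeLT x d
      · rw [vproj_mul_vproj_of_ne h]
        exact zero_mem _
    · rw [← mul_assoc]
      by_cases h : x = ε.src
      · subst h
        rw [vproj_mul_edgeOp_src]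
        exact edgeOp_mul_mem_degreeLT ε (hQ ε)
      · rw [vproj_mul_edgeOp_of_ne h, zero_mul]
        exact zero_mem _

theorem mul_vproj_mem_degreeLT (x : V(G)) {d : ℕ} {P : Fock G →L[ℂ] Fock G}
    (hP : P ∈ degreeLT μ d) : P * vproj x ∈ degreeLT μ d := by
  induction d generalizing P with
  | zero =>
    rw [degreeLT, Submodule.mem_bot] at hP ⊢
    rw [hP, zero_mul]
  | succ d ih =>
    obtain ⟨c, Q, hQ, rfl⟩ := mem_degreeLT_succ.1 hP
    rw [add_mul, Finset.sum_mul, Finset.sum_mul]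
    refine add_mem (sum_mem fun y _ => ?_) (sum_mem fun ε _ => ?_)
    · rw [smul_mul_assoc]
      refine Submodule.smul_mem _ _ ?_
      by_cases h : y = x
      · subst h
        rw [vproj_mul_vproj_self]
        exact vproj_mem_degreeLT y d
      · rw [vproj_mul_vproj_of_ne h]
        exact zero_mem _
    · rw [mul_assoc]
      exact edgeOp_mul_mem_degreeLT ε (ih (hQ ε))

theorem degreeLT_le_polyAlg (d : ℕ) : degreeLT μ d ≤ (polyAlg μ).toSubmodule := by
  induction d with
  | zero => exact bot_le
  | succ d ih =>
    intro P hP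
    obtain ⟨c, Q, hQ, rfl⟩ := mem_degreeLT_succ.1 hP
    exact add_mem (sum_mem fun x _ => Submodule.smul_mem _ _
        (Algebra.subset_adjoin (Or.inr ⟨x, rfl⟩)))
      (sum_mem fun ε _ => (polyAlg μ).mul_mem (Algebra.subset_adjoin (Or.inl ⟨ε, rfl⟩)) (ih (hQ ε)))

theorem exists_mem_degreeLT {P : Fock G →L[ℂ] Fock G} (hP : P ∈ polyAlg μ) :
    ∃ d, P ∈ degreeLT μ d := by
  -- Degree is defined by peeling letters off the left, so the induction is run on left
  -- multiplication and then applied to the unit.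
  have key : ∀ d, ∀ Q ∈ degreeLT μ d, ∃ e, P * Q ∈ degreeLT μ e := by
    induction hP using Algebra.adjoin_induction with
    | mem P hP =>
      intro d Q hQ
      rcases hP with ⟨ε, rfl⟩ | ⟨x, rfl⟩
      · exact ⟨d + 1, edgeOp_mul_mem_degreeLT ε hQ⟩
      · exact ⟨d, vproj_mul_mem_degreeLT x hQ⟩
    | algebraMap c =>
      intro d Q hQ
      rw [← Algebra.smul_def]
      exact ⟨d, Submodule.smul_mem _ _ hQ⟩
    | add S T _ _ hS hT =>
      intro d Q hQ
      obtain ⟨j, hj⟩ := hS d Q hQ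
      obtain ⟨k, hk⟩ := hT d Q hQ
      rw [add_mul]
      exact ⟨max j k, add_mem (degreeLT_mono (le_max_left j k) hj)
        (degreeLT_mono (le_max_right j k) hk)⟩
    | mul S T _ _ hS hT =>
      intro d Q hQ
      obtain ⟨j, hj⟩ := hT d Q hQ
      rw [mul_assoc]
      exact hS j _ hj
  have h1 : (1 : Fock G →L[ℂ] Fock G) ∈ degreeLT μ 1 := by
    rw [← sum_vproj]
    exact sum_mem fun x _ => vproj_mem_degreeLT x 0
  obtain ⟨e, he⟩ := key 1 1 h1
  exact ⟨e, by rwa [mul_one] at he⟩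

/-! ### The free difference quotients -/

/-- Leibniz rule: `rightAnn ε` commutes with `edgeOp μ d` up to a rank one operator, present only
for d = ε, so the commutator with the sum consists of a vacuum coefficient of Q ε and of the
commutators with the Q d. Pairing with ξ moves each `edgeOp μ d` onto ξ, which is why the hypothesis
is needed for all vectors. The leading part of the result is an explicit multiple of Q ε; the rest,
B, has lower degree. -/
theorem exists_inner_commutator_of_sum {d : ℕ} {c : V(G) → ℂ} {Q : OEdge G → Fock G →L[ℂ] Fock G}
    (hQ : ∀ ε (ξ : Fock G) (d' : OEdge G), ∃ B ∈ degreeLT μ (d - 1), ∀ η,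
      inner ℂ ξ (rightAnn d' (Q ε η) - Q ε (rightAnn d' η)) = pathCoeff d'.tgt [] (B η))
    (ξ : Fock G) (ε : OEdge G) : ∃ B ∈ degreeLT μ (d - 1), ∀ η,
      inner ℂ ξ (rightAnn ε ((∑ x, c x • vproj x + ∑ ε, edgeOp μ ε * Q ε) η) -
        (∑ x, c x • vproj x + ∑ ε, edgeOp μ ε * Q ε) (rightAnn ε η)) =
      pathCoeff ε.tgt [] ((((edgeWeight μ ε : ℂ) * inner ℂ ξ (vac ε.src)) • Q ε + B) η) := by
  classical
  choose B hB hBη using fun d => hQ d (star (edgeOp μ d) ξ) ε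
  refine ⟨∑ d, B d, sum_mem fun d _ => hB d, fun η => ?_⟩
  have h1 : ∀ d f, rightAnn ε (edgeOp μ d f) = edgeOp μ d (rightAnn ε f) +
      if d = ε then ((edgeWeight μ ε : ℂ) * pathCoeff ε.tgt [] f) • vac ε.src else 0 := by
    intro d f
    rw [edgeOp, add_apply, add_apply, smul_apply, smul_apply, smul_apply, smul_apply, map_add,
      map_smul, map_smul, rightAnn_creation, rightAnn_adjoint_creation, smul_add]
    by_cases h : d = ε
    · subst h
      rw [if_pos rfl, if_pos rfl, smul_smul]
      abel
    · rw [if_neg h, if_neg h]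
      simp
  have h2 : rightAnn ε ((∑ x, c x • vproj x + ∑ ε, edgeOp μ ε * Q ε) η) -
        (∑ x, c x • vproj x + ∑ ε, edgeOp μ ε * Q ε) (rightAnn ε η) =
      ∑ d, edgeOp μ d (rightAnn ε (Q d η) - Q d (rightAnn ε η)) +
        ((edgeWeight μ ε : ℂ) * pathCoeff ε.tgt [] (Q ε η)) • vac ε.src := by
    simp only [add_apply, sum_apply, smul_apply, mul_apply_eq_comp, map_add, map_sum, map_smul,
      rightAnn_vproj, h1, Finset.sum_add_distrib, Finset.sum_ite_eq', Finset.mem_univ, if_true,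
      map_sub, Finset.sum_sub_distrib]
    abel
  rw [h2, inner_add_right, inner_sum, inner_smul_right, add_apply, smul_apply, map_add, map_smul,
    sum_apply, map_sum, add_comm]
  congr 1
  · rw [smul_eq_mul]
    ring
  · refine Finset.sum_congr rfl fun d _ => ?_
    rw [← hBη d η, ContinuousLinearMap.star_eq_adjoint, ContinuousLinearMap.adjoint_inner_left]

theorem exists_inner_commutator {d : ℕ} {P : Fock G →L[ℂ] Fock G} (hP : P ∈ degreeLT μ d)
    (ξ : Fock G) (ε : OEdge G) : ∃ B ∈ degreeLT μ (d - 1), ∀ η,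
      inner ℂ ξ (rightAnn ε (P η) - P (rightAnn ε η)) = pathCoeff ε.tgt [] (B η) := by
  induction d generalizing P ξ ε with
  | zero =>
    rw [degreeLT, Submodule.mem_bot] at hP
    exact ⟨0, zero_mem _, fun η => by simp [hP]⟩
  | succ d ih =>
    obtain ⟨c, Q, hQ, rfl⟩ := mem_degreeLT_succ.1 hP
    obtain ⟨B, hB, h⟩ := exists_inner_commutator_of_sum (c := c)
      (fun ε ξ d' => ih (hQ ε) ξ d') ξ ε
    exact ⟨_, add_mem (Submodule.smul_mem _ _ (hQ ε)) (degreeLT_mono (Nat.sub_le d 1) hB), h⟩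

/-! ### Absence of zero divisors in the corner of a vertex of minimal weight -/

/-- Each left quotient Q ε of P inherits, up to lower degree terms, the relation with w, so it is of
lower degree by induction; hence so is P. The target vertex y varies because the quotients land in
the corners at the targets of the edges. -/
theorem eq_zero_of_mul_eq_zero_of_mem_degreeLT (hμ : ∀ x, 0 < μ x) {x : V(G)}
    (hx : ∀ y, μ x ≤ μ y) {w : Fock G →L[ℂ] Fock G} (hw : w ∈ rightCommutant μ) (hw0 : w ≠ 0)
    (hwx : vproj x * w = w) {d : ℕ} {y : V(G)} {P : Fock G →L[ℂ] Fock G}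
    (hPd : P ∈ degreeLT μ d) (hP : vproj y * P * vproj x = P) (hPw : P * w = 0) : P = 0 := by
  classical
  induction d generalizing y P with
  | zero => rwa [degreeLT, Submodule.mem_bot] at hPd
  | succ d ih =>
    obtain ⟨ξ, hξ, hξy⟩ := exists_star_apply_eq_zero hμ (hx y) (degreeLT_le_polyAlg _ hPd) hP hw
      hw0 hwx hPw
    obtain ⟨c, Q, hQ, hPQ⟩ := mem_degreeLT_succ.1 hPd
    have hcorner : ∀ ε : OEdge G, ε.src = y →
        vproj ε.tgt * Q ε * vproj x ∈ degreeLT μ (d - 1) := by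
      intro ε hε
      obtain ⟨B, hB, hBη⟩ := exists_inner_commutator_of_sum (c := c)
        (fun ε ξ d' => exists_inner_commutator (hQ ε) ξ d') ξ ε
      rw [← hPQ] at hBη
      set κ : ℂ := (edgeWeight μ ε : ℂ) * inner ℂ ξ (vac ε.src) with hκ
      have hκ0 : κ ≠ 0 := by
        refine mul_ne_zero (by exact_mod_cast (edgeWeight_pos hμ ε).ne') ?_
        rw [hε, ← inner_conj_symm, inner_vac]
        simpa using hξy
      -- On the range of w both terms of the commutator die when paired with ξ: one because P w = 0,
      -- the other because P* ξ = 0.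
      have h1 : ∀ ζ, pathCoeff ε.tgt [] (((κ • Q ε + B) * w) ζ) = 0 := by
        intro ζ
        rw [mul_apply_eq_comp, ← hBη, ← mul_apply_eq_comp P w, hPw, zero_apply, map_zero, zero_sub,
          inner_neg_right, ← ContinuousLinearMap.adjoint_inner_left,
          ← ContinuousLinearMap.star_eq_adjoint, hξ, inner_zero_left, neg_zero]
      have hBd : B ∈ degreeLT μ d := degreeLT_mono (Nat.sub_le d 1) hB
      have hmem : κ • Q ε + B ∈ degreeLT μ d := add_mem (Submodule.smul_mem _ _ (hQ ε)) hBd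
      have h2 : vproj ε.tgt * ((κ • Q ε + B) * w) = 0 :=
        pathCoeff_eq_zero_of_mem_rightCommutant hμ
          (mul_mem (polyAlg_le_rightCommutant hμ (degreeLT_le_polyAlg _ hmem)) hw) h1
      have h3 : vproj ε.tgt * (κ • Q ε + B) * vproj x = 0 := by
        refine ih (y := ε.tgt) (mul_vproj_mem_degreeLT x (vproj_mul_mem_degreeLT _ hmem)) ?_ ?_
        · rw [mul_assoc, mul_assoc _ (vproj x), vproj_mul_vproj_self, ← mul_assoc, ← mul_assoc,
            vproj_mul_vproj_self]
        · rw [mul_assoc, hwx, mul_assoc, h2]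
      have h4 : vproj ε.tgt * Q ε * vproj x = -(κ⁻¹ • (vproj ε.tgt * B * vproj x)) := by
        rw [mul_add, add_mul, mul_smul_comm, smul_mul_assoc, add_eq_zero_iff_eq_neg] at h3
        rw [← smul_neg, ← h3, smul_smul, inv_mul_cancel₀ hκ0, one_smul]
      rw [h4]
      exact neg_mem (Submodule.smul_mem _ _
        (mul_vproj_mem_degreeLT x (vproj_mul_mem_degreeLT _ hB)))
    have hsum : P = (if y = x then c x else 0) • vproj x +
        ∑ ε : OEdge G with ε.src = y, edgeOp μ ε * (vproj ε.tgt * Q ε * vproj x) := by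
      rw [← hP, hPQ, mul_add, add_mul, Finset.mul_sum, Finset.mul_sum, Finset.sum_mul,
        Finset.sum_mul]
      congr 1
      · rw [Finset.sum_eq_single y]
        · rw [mul_smul_comm, smul_mul_assoc, vproj_mul_vproj_self]
          split_ifs with h
          · rw [h, vproj_mul_vproj_self]
          · rw [vproj_mul_vproj_of_ne h]
            simp
        · intro z _ hz
          rw [mul_smul_comm, vproj_mul_vproj_of_ne (Ne.symm hz)]
          simp
        · simp
      · rw [Finset.sum_filter]
        refine Finset.sum_congr rfl fun ε _ => ?_
        split_ifs with h
        · rw [← mul_assoc (vproj y), ← h, vproj_mul_edgeOp_src]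
          conv_lhs => rw [← edgeOp_mul_vproj_tgt]
          simp only [mul_assoc]
        · rw [← mul_assoc (vproj y), vproj_mul_edgeOp_of_ne (Ne.symm h)]
          simp
    -- The truncated bound d - 1 gives no descent at d = 0. There the quotients are zero and P is a
    -- multiple of `vproj x`, whose product with w vanishes only if the multiple does.
    cases d with
    | zero =>
      have h0 : P = (if y = x then c x else 0) • vproj x := by
        conv_lhs => rw [hsum]
        rw [add_eq_left]
        refine Finset.sum_eq_zero fun ε _ => ?_
        have := hQ ε
        rw [degreeLT, Submodule.mem_bot] at this
        rw [this]
        simp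
      rw [h0, smul_mul_assoc, hwx, smul_eq_zero] at hPw
      rw [h0, hPw.resolve_right hw0, zero_smul]
    | succ d =>
      refine ih (y := y) ?_ hP hPw
      rw [hsum]
      refine add_mem (Submodule.smul_mem _ _ (vproj_mem_degreeLT x d)) (sum_mem fun ε hε => ?_)
      exact edgeOp_mul_mem_degreeLT ε (hcorner ε (Finset.mem_filter.1 hε).2)

/-- The kernel of P is invariant under the right operators, whose family is closed under adjoints,
so its projection lies in the commutant. Cut down by `vproj x`, it is killed by P and must vanish by
the absence of zero divisors. -/
theorem starProjection_ker_vac_eq_zero (hμ : ∀ x, 0 < μ x) {x : V(G)} (hx : ∀ y, μ x ≤ μ y)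
    {P : Fock G →L[ℂ] Fock G} (hPA : P ∈ polyAlg μ)
    (hP : vproj x * P * vproj x = P) (hP0 : P ≠ 0) : P.ker.starProjection (vac x) = 0 := by
  set p := P.ker.starProjection with hp
  have hPR := polyAlg_le_rightCommutant hμ hPA
  have hker : ∀ ε, ∀ f ∈ P.ker, rightOp μ ε f ∈ P.ker := by
    intro ε f hf
    have hf' : P f = 0 := hf
    change P (rightOp μ ε f) = 0
    rw [← mul_apply_eq_comp, ← mem_rightCommutant.1 hPR, mul_apply_eq_comp, hf', map_zero]
  have hpR : p ∈ rightCommutant μ := by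
    rw [mem_rightCommutant]
    intro ε
    refine (starProjection_apply_comm (hker ε) ?_).symm
    rw [star_rightOp]
    exact hker ε.op
  have hPp : P * p = 0 := by
    ext1 f
    exact Submodule.starProjection_apply_mem P.ker f
  have hPx : P * vproj x = P := by
    rw [← hP, mul_assoc, vproj_mul_vproj_self]
  have hw : vproj x * p = 0 := by
    by_contra hw0
    obtain ⟨d, hd⟩ := exists_mem_degreeLT hPA
    refine hP0 (eq_zero_of_mul_eq_zero_of_mem_degreeLT hμ hx
      (mul_mem (vproj_mem_rightCommutant x) hpR) hw0 ?_ hd hP ?_)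
    · rw [← mul_assoc, vproj_mul_vproj_self]
    · rw [← mul_assoc, hPx, hPp]
  have h1 : pathCoeff x [] (p (vac x)) = 0 := by
    classical
    have := congrArg (fun T : Fock G →L[ℂ] Fock G => pathCoeff x [] (T (vac x))) hw
    rwa [mul_apply_eq_comp, pathCoeff_vproj, if_pos rfl, zero_apply, map_zero] at this
  rw [← inner_vac] at h1
  rw [← inner_self_eq_zero (𝕜 := ℂ)]
  nth_rw 1 [hp]
  rw [Submodule.inner_starProjection_left_eq_right, Submodule.starProjection_eq_self_iff.2]
  · exact h1
  · exact Submodule.starProjection_apply_mem _ (vac x)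

/-- The law of a nonzero positive polynomial in the corner at a vertex of minimal weight has no
atom at zero. -/
theorem law_cornerTrace_singleton_zero (hμ : ∀ x, 0 < μ x) {x : V(G)} (hx : ∀ y, μ x ≤ μ y)
    {P : Fock G →L[ℂ] Fock G} (hPA : P ∈ polyAlg μ) (hpos : 0 ≤ P)
    (hP : vproj x * P * vproj x = P) (hP0 : P ≠ 0) :
    law (cornerTrace μ x) P (IsSelfAdjoint.of_nonneg hpos) {0} = 0 := by
  have hproj := starProjection_ker_vac_eq_zero hμ hx hPA hP hP0
  have h1 := tendsto_ringInverse_of_starProjection_ker hpos hproj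
  -- The mass at zero is the limit of the resolvent transform, and the resolvents applied to the
  -- vacuum tend to zero.
  have h2 := tendsto_integral_inv_one_add_mul (law_Iio_zero (cornerTrace μ x) hpos)
  have h3 : Tendsto (fun s : ℝ => ((μ x : ℂ) *
      pathCoeff x [] (Ring.inverse (1 + (s : ℂ) • P) (vac x))).re) atTop (𝓝 0) := by
    have h4 : Tendsto (fun s : ℝ => (μ x : ℂ) *
        pathCoeff x [] (Ring.inverse (1 + (s : ℂ) • P) (vac x))) atTop (𝓝 0) := by
      have := (((pathCoeff x []).continuous.tendsto 0).comp h1).const_mul (μ x : ℂ)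
      rwa [map_zero, mul_zero] at this
    exact (Complex.continuous_re.tendsto 0).comp h4
  have h5 : (fun s : ℝ => ∫ t, (1 + s * t)⁻¹
      ∂(law (cornerTrace μ x) P (IsSelfAdjoint.of_nonneg hpos))) =ᶠ[atTop]
      fun s : ℝ => ((μ x : ℂ) *
        pathCoeff x [] (Ring.inverse (1 + (s : ℂ) • P) (vac x))).re := by
    filter_upwards [eventually_ge_atTop 0] with s hs
    rw [← cornerTrace_apply, ← coe_integral_inv_one_add_mul_law (cornerTrace μ x) hpos hs,
      Complex.ofReal_re]
  have h6 := tendsto_nhds_unique (h2.congr' h5) h3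
  rwa [measureReal_eq_zero_iff] at h6

end FreeGraph

end

/-! ### Integrability of the logarithm and absence of the atom -/

theorem mainTheorem5 {V : Type*} {E : Type*} (G : Graph V E) [Fintype V(G)] [Finite E(G)]
    (hG : FreeGraph.IsConnected G) (μ : V(G) → ℝ≥0) (hμ : ∀ x, 0 < μ x) :
    (∀ (n : ℕ) (_ : 1 ≤ n)
        (P : CStarMatrix (Fin n) (Fin n) (FreeGraph.Fock G →L[ℂ] FreeGraph.Fock G))
        (_ : ∀ i j, P i j ∈ FreeGraph.polyAlg μ) (hP : 0 ≤ P) (ν : Measure ℝ)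
        (_ : ν = law (FreeGraph.matrixTrace μ n) P (IsSelfAdjoint.of_nonneg hP)),
      (IntegrableOn (fun t => (ν.real (Iic t) - ν.real (Iic 0)) / t) (Ioc 0 ‖P‖) volume ∧
        Tendsto (fun δ => ∫ t in Ioc δ ‖P‖, (ν.real (Iic t) - ν.real (Iic 0)) / t) (𝓝[>] 0)
          (𝓝 (∫ t in Ioc 0 ‖P‖, (ν.real (Iic t) - ν.real (Iic 0)) / t))) ∧
      (IntegrableOn Real.log (Ioc 0 ‖P‖) ν ∧
        Tendsto (fun δ => ∫ t in Icc δ ‖P‖, Real.log t ∂ν) (𝓝[>] 0)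
          (𝓝 (∫ t in Ioc 0 ‖P‖, Real.log t ∂ν)))) ∧
    (∀ (x : V(G)) (_ : ∀ y, μ x ≤ μ y) (P : FreeGraph.Fock G →L[ℂ] FreeGraph.Fock G)
        (_ : P ∈ FreeGraph.polyAlg μ) (hP : 0 ≤ P)
        (_ : FreeGraph.vproj x * P * FreeGraph.vproj x = P) (_ : P ≠ 0) (ν : Measure ℝ)
        (_ : ν = law (FreeGraph.cornerTrace μ x) P (IsSelfAdjoint.of_nonneg hP)),
      ν {0} = 0 ∧ IntegrableOn Real.log (Icc 0 ‖P‖) ν) := by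
  refine ⟨fun n _ P hPA hP ν hν => ?_, fun x hx P hPA hP hPx hP0 ν hν => ?_⟩
  · subst hν
    obtain ⟨C, a, ha, hC⟩ := FreeGraph.exists_measureReal_law_matrixTrace_le μ hPA hP
    have h1 := integrableOn_div_of_measureReal_Ioc_le ha hC ‖P‖
    have h2 := integrableOn_log_of_measureReal_Ioc_le ha hC ‖P‖
    exact ⟨⟨h1, tendsto_integral_Ioc h1⟩, h2, tendsto_integral_Icc h2⟩
  · subst hν
    have := Fintype.ofFinite (FreeGraph.OEdge G)
    have h0 := FreeGraph.law_cornerTrace_singleton_zero hμ hx hPA hP hPx hP0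
    obtain ⟨C, a, ha, hC⟩ := FreeGraph.exists_measureReal_law_cornerTrace_le μ x hPA hP
    have h2 := integrableOn_log_of_measureReal_Ioc_le ha hC ‖P‖
    refine ⟨h0, ?_⟩
    -- Including the endpoint 0 costs nothing because it has no mass. As `Real.log 0 = 0` by
    -- convention, integrability alone would not detect an atom there, so the vanishing of ν {0} is
    -- a separate conclusion.
    rw [← Icc_union_Ioc_eq_Icc le_rfl (norm_nonneg P), Icc_self]
    exact IntegrableOn.union (integrableOn_singleton enorm_ne_top (h0 ▸ ENNReal.zero_lt_top)) h2
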